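/- \textbf{Theorem (Moments, $a_i=1$).} Let $1\le M\le N$ be integers and let $b=(b_0,b_1,\dots,b_N)$ with all $b_k>0$. For $m\ge 0$ let $L_m(w)$, $\Re(w)>0$, be the Barnes multiple log-gamma function with parameters $a_1=\dots=a_m=1$, that is, \[ L_m(w)=\partial_s\zeta_m(s,w)\big|_{s=0},\qquad \zeta_m(s,w)=\frac1{\Gamma(s)}\int_0^\infty t^{s-1}e^{-wt}(1-e^{-t})^{-m}\,dt\quad(\Re(s)>m), \] where $\zeta_m(\cdot,w)$ is continued analytically to $\mathbb{C}\setminus\{1,\dots,m\}$ (so $L_0(w)=-\log w$). For a function $f$ put \[ (\mathcal{S}_Nf)(q\,|\,b)=\sum_{p=0}^N(-1)^p\sum_{1\le k_1<\dots<k_p\le N} f(q+b_0+b_{k_1}+\dots+b_{k_p}). \] There is a unique probability distribution $\beta_{M,N}=\beta_{M,N}(b)$ on $(0,1]$ whose Mellin transform is \[ \mathbf{E}[\beta_{M,N}^q]=\exp\bigl((\mathcal{S}_NL_M)(q\,|\,b)-(\mathcal{S}_NL_M)(0\,|\,b)\bigr),\qquad \Re(q)>-b_0, \] and for every integer $n\ge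 0$ its $n$-th moment is finite and satisfies \begin{align*} \mathbf{E}[\beta_{M,N}^n] &=\prod_{i=1}^{M-1}e^{(-1)^i\binom ni(\mathcal{S}_NL_{M-i})(0\,|\,b)}\ \prod_{i_1=0}^{n-1}\prod_{i_2=0}^{i_1-1}\cdots\prod_{i_M=0}^{i_{M-1}-1}e^{(-1)^M(\mathcal{S}_NL_0)(i_M\,|\,b)}\\ &=\prod_{i=1}^{M-1}e^{(-1)^i\binom ni(\mathcal{S}_NL_{M-i})(0\,|\,b)}\ \prod_{i_1=0}^{n-1}\prod_{i_2=0}^{i_1-1}\cdots\prod_{i_M=0}^{i_{M-1}-1} \Biggl[\frac{\prod_{p\ \mathrm{odd}}P_p(i_M)}{\prod_{p\ \mathrm{even}}P_p(i_M)}\Biggr]^{(-1)^M}, \end{align*} where $p$ runs over $0\le p\le N$ and $P_p(x)=\prod_{1\le j_1<\dots<j_p\le N}(x+b_0+b_{j_1}+\dots+b_{j_p})$, so $P_0(x)=x+b_0$. Empty products are $1$. -/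

import Mathlib

open MeasureTheory Finset

noncomputable section

namespace BarnesBeta

/-- The function `f(t) = t^M ∏_{j=1}^M (1 - e^{-a_j t})⁻¹` attached to `a = (a_1, …, a_M)`. -/
def ruijF {M : ℕ} (a : Fin M → ℝ) (t : ℝ) : ℝ :=
  t ^ M * ∏ j, (1 - Real.exp (-(a j * t)))⁻¹

/-- The integral `Γ(s)⁻¹ ∫₀^∞ t^{s-1} e^{-wt} f(t) t^{-M} dt`, which defines the Barnes multiple
zeta function `ζ_M(s, w | a)` for `Re s > M`, `Re w > 0`. -/
def zetaIntegral {M : ℕ} (a : Fin M → ℝ) (w s : ℂ) : ℂ :=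
  (Complex.Gamma s)⁻¹ *
    ∫ t in Set.Ioi (0 : ℝ),
      (t : ℂ) ^ (s - 1) * Complex.exp (-(w * t)) * ((ruijF a t / t ^ M : ℝ) : ℂ)

/-- `Z` is an analytic continuation of `s ↦ ζ_M(s, w | a)` to `ℂ ∖ {1, …, M}`. As this set is open
and connected, `Z` is determined on it. -/
structure IsZetaContinuation {M : ℕ} (a : Fin M → ℝ) (w : ℂ) (Z : ℂ → ℂ) : Prop where
  differentiableOn : DifferentiableOn ℂ Z {s : ℂ | ∀ k ∈ Finset.Icc 1 M, s ≠ (k : ℂ)}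
  eq_integral : ∀ s : ℂ, (M : ℝ) < s.re → Z s = zetaIntegral a w s

open Classical in
/-- The Barnes multiple zeta function `s ↦ ζ_M(s, w | a)`, `Re w > 0`, on `ℂ ∖ {1, …, M}`. -/
def zeta {M : ℕ} (a : Fin M → ℝ) (w : ℂ) : ℂ → ℂ :=
  if h : ∃ Z : ℂ → ℂ, IsZetaContinuation a w Z then h.choose else 0

/-- The Barnes multiple log-gamma function `L_M(w | a) = ∂_s ζ_M(s, w | a)` at `s = 0`,
for `Re w > 0`. -/
def logGamma {M : ℕ} (a : Fin M → ℝ) (w : ℂ) : ℂ :=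
  deriv (zeta a w) 0

/-- The operator `(S_N f)(q | b)`, the sum over `p = 0, …, N` of
`(-1)^p ∑_{k_1 < ⋯ < k_p} f (q + b_0 + b_{k_1} + ⋯ + b_{k_p})`,
for `b = (b_0, …, b_N)` and indices `k_i` in `{1, …, N}`. -/
def opS {N : ℕ} (b : Fin (N + 1) → ℝ) (f : ℂ → ℂ) (q : ℂ) : ℂ :=
  ∑ p ∈ Finset.range (N + 1), (-1 : ℂ) ^ p *
    ∑ K ∈ Finset.powersetCard p (Finset.univ : Finset (Fin N)),
      f (q + (b 0 : ℂ) + ∑ k ∈ K, (b k.succ : ℂ))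

/-- `η_{M,N}(q | a, b) = exp ((S_N L_M)(q | b) - (S_N L_M)(0 | b))`, for `Re q > -b_0`. -/
def eta {M N : ℕ} (a : Fin M → ℝ) (b : Fin (N + 1) → ℝ) (q : ℂ) : ℂ :=
  Complex.exp (opS b (logGamma a) q - opS b (logGamma a) 0)

/-- `μ` is the Barnes beta distribution `β_{M,N}(a, b)`: the probability distribution on `(0, 1]`
whose Mellin transform is `∫ x^q dμ(x) = η_{M,N}(q | a, b)` for `Re q > -b_0`. -/
structure IsBarnesBeta {M N : ℕ} (a : Fin M → ℝ) (b : Fin (N + 1) → ℝ) (μ : Measure ℝ) :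
    Prop where
  isProbabilityMeasure : IsProbabilityMeasure μ
  supported : μ (Set.Ioc 0 1)ᶜ = 0
  integrable : ∀ q : ℂ, -b 0 < q.re → Integrable (fun x : ℝ => (x : ℂ) ^ q) μ
  mellin : ∀ q : ℂ, -b 0 < q.re → ∫ x : ℝ, (x : ℂ) ^ q ∂μ = eta a b q

/-- The nested product of depth `M`, in which `i_1` runs over `0, …, n - 1`, `i_2` over
`0, …, i_1 - 1`, and so on up to `i_M` over `0, …, i_{M-1} - 1`, with the factors `g i_M`. -/
def nestedProd (g : ℕ → ℂ) : ℕ → ℕ → ℂ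
  | 0, n => g n
  | M + 1, n => ∏ i ∈ Finset.range n, nestedProd g M i

/-- The product of `x + b_0 + b_{j_1} + ⋯ + b_{j_p}` over all `1 ≤ j_1 < ⋯ < j_p ≤ N`. -/
def linProd {N : ℕ} (b : Fin (N + 1) → ℝ) (p : ℕ) (x : ℝ) : ℝ :=
  ∏ J ∈ Finset.powersetCard p (Finset.univ : Finset (Fin N)),
    (x + b 0 + ∑ j ∈ J, b j.succ)

/-- The alternating product of linear factors: the products over an odd number `p ≤ N` of indices
stand in the numerator, those over an even number `p ≤ N` (`p = 0` included) in the denominator. -/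
def altProd {N : ℕ} (b : Fin (N + 1) → ℝ) (x : ℝ) : ℝ :=
  (∏ p ∈ (Finset.range (N + 1)).filter Odd, linProd b p x) /
    ∏ p ∈ (Finset.range (N + 1)).filter Even, linProd b p x

end BarnesBeta

end

open Filter Topology Asymptotics

noncomputable section

namespace BarnesBeta

/-! Applied to `e^{-wt}`, the operator `S_N` is inclusion-exclusion and produces `e^{-(q+b_0)t} ∏ (1
- e^{-b_j t})`. Hence the exponent of `eta` is `∫ (e^{-qt} - 1) k(t) dt/t` with `k(t) = e^{-b_0 t} ∏
(1 - e^{-b_j t}) (1 - e^{-t})^{-M} ≥ 0` (`opS_logGamma_sub`). This is the Lévy-Khinchin exponent of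
a nonnegative random variable `X`, and the Barnes beta variable is `e^{-X}`.

The law of `X` is built explicitly. If `M < N`, then `k(t)/t` is integrable and `X` is compound
Poisson (`exists_exp`). If `M = N`, then `k(0+) > 0` and `k(t)/t` has infinite mass at `0`;
subtracting a suitable Gamma Lévy density leaves a nonnegative integrable remainder, so `X` is an
independent sum of a Gamma and a compound Poisson variable (`exists_isLaplace_eta`). Uniqueness
follows because the Mellin transform on the imaginary axis is the characteristic function of the
logarithm.

The moments are values of `eta` at integers. The recurrence `L_{m+1}(w+1) = L_{m+1}(w) - L_m(w)`
(`logGamma_add_one`) passes through `S_N`, and solving this system of difference equations `M` times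
descends to `L_0 = -log`, which gives the rational factors.

Both the integral formula (`sum_logGamma_eq_integral`) and the recurrence concern the continued zeta
function at `s = 0`. They are proved where the defining integrals converge and carried to `0` by the
identity theorem (`deriv_zero_eq_of_eq_right`), once the continuation is known to exist
(`exists_isZetaContinuation`). -/

/-! ### The Gamma integral with complex rate -/

lemma integrableOn_cpow_mul_exp_neg_mul {a r : ℂ} (ha : 0 < a.re) (hr : 0 < r.re) :
    IntegrableOn (fun t : ℝ => (t : ℂ) ^ (a - 1) * Complex.exp (-(r * t))) (Set.Ioi 0) := by
  have hm : AEStronglyMeasurable (fun t : ℝ => (t : ℂ) ^ (a - 1) * Complex.exp (-(r * t)))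
      (volume.restrict (Set.Ioi 0)) := by
    refine ContinuousOn.aestronglyMeasurable ?_ measurableSet_Ioi
    refine ContinuousOn.mul (fun t ht => ?_) (by fun_prop)
    exact (Complex.continuousAt_ofReal_cpow_const t _ (Or.inr (ne_of_gt ht))).continuousWithinAt
  have h := integrableOn_rpow_mul_exp_neg_mul_rpow (p := 1) (s := a.re - 1) (b := r.re)
    (by linarith) one_pos hr
  refine (integrable_norm_iff hm).mp (h.congr ?_)
  filter_upwards [ae_restrict_mem measurableSet_Ioi] with t ht
  rw [norm_mul, Complex.norm_cpow_eq_rpow_re_of_pos ht, Complex.norm_exp]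
  simp

lemma differentiableAt_integral_cpow_mul_exp_neg_mul {a r : ℂ} (ha : 0 < a.re) (hr : 0 < r.re) :
    DifferentiableAt ℂ
      (fun z : ℂ => ∫ t in Set.Ioi (0 : ℝ), (t : ℂ) ^ (a - 1) * Complex.exp (-(z * t))) r := by
  -- On the ball of this radius `Re z > Re r / 2`, and differentiation brings down one factor `t`;
  -- this explains the exponent `a + 1` and the rate `Re r / 2` of the dominating function.
  have hε : 0 < r.re / 2 := half_pos hr
  have hb := (integrableOn_cpow_mul_exp_neg_mul (a := a + 1) (r := ((r.re / 2 : ℝ) : ℂ))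
    (by simp; linarith) (by simpa using hr)).norm
  refine (hasDerivAt_integral_of_dominated_loc_of_deriv_le
    (μ := volume.restrict (Set.Ioi (0 : ℝ)))
    (F := fun z (t : ℝ) => (t : ℂ) ^ (a - 1) * Complex.exp (-(z * t)))
    (F' := fun z t => (t : ℂ) ^ (a - 1) * (Complex.exp (-(z * t)) * (-(t : ℂ))))
    (Metric.ball_mem_nhds r hε) ?_ (integrableOn_cpow_mul_exp_neg_mul ha hr) ?_ ?_ hb
    ?_).2.differentiableAt
  · filter_upwards [Complex.continuous_re.continuousAt.eventually (lt_mem_nhds hr)] with z hz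
    exact (integrableOn_cpow_mul_exp_neg_mul ha hz).1
  · have := (integrableOn_cpow_mul_exp_neg_mul ha hr).1.mul
      (g := fun t : ℝ => -(t : ℂ)) (by fun_prop)
    refine this.congr (Eventually.of_forall fun t => ?_)
    simp [mul_assoc]
  · filter_upwards [ae_restrict_mem measurableSet_Ioi] with t ht z hz
    have ht : 0 < t := ht
    have hz' : r.re / 2 < z.re := by
      have h1 := (Complex.abs_re_le_norm (z - r)).trans_lt (by simpa [dist_eq_norm] using hz)
      have := (abs_lt.mp h1).1
      simp at this
      linarith
    rw [norm_mul, norm_mul, norm_mul, Complex.norm_cpow_eq_rpow_re_of_pos ht,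
      Complex.norm_cpow_eq_rpow_re_of_pos ht, Complex.norm_exp, Complex.norm_exp, norm_neg,
      Complex.norm_real, Real.norm_of_nonneg ht.le, mul_left_comm, mul_comm]
    have h2 : t ^ (a + 1 - 1).re = t ^ (a - 1).re * t := by
      rw [← Real.rpow_add_one ht.ne']
      simp
    rw [h2, mul_comm, mul_comm (t ^ _ * t), mul_comm (t ^ _) t, ← mul_assoc, mul_assoc _ t]
    have h3 : Real.exp (-(z * t)).re ≤ Real.exp (-(((r.re / 2 : ℝ) : ℂ) * t)).re := by
      refine Real.exp_le_exp.mpr ?_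
      rw [Complex.neg_re, Complex.neg_re, Complex.re_mul_ofReal, Complex.re_mul_ofReal,
        Complex.ofReal_re]
      nlinarith
    gcongr
  · filter_upwards with t z hz
    have h1 : HasDerivAt (fun z : ℂ => -(z * (t : ℂ))) (-(t : ℂ)) z := by
      simpa using ((hasDerivAt_id z).mul_const (t : ℂ)).fun_neg
    exact h1.cexp.const_mul _

/-- Both sides are holomorphic in `r` on the right half-plane and agree at positive reals, which
accumulate at `1`. -/
theorem integral_cpow_mul_exp_neg_mul {a r : ℂ} (ha : 0 < a.re) (hr : 0 < r.re) :
    ∫ t in Set.Ioi (0 : ℝ), (t : ℂ) ^ (a - 1) * Complex.exp (-(r * t)) =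
      (1 / r) ^ a * Complex.Gamma a := by
  have hU : IsOpen {z : ℂ | 0 < z.re} := isOpen_lt continuous_const Complex.continuous_re
  have hf : AnalyticOnNhd ℂ (fun z : ℂ => ∫ t in Set.Ioi (0 : ℝ),
      (t : ℂ) ^ (a - 1) * Complex.exp (-(z * t))) {z : ℂ | 0 < z.re} :=
    DifferentiableOn.analyticOnNhd (fun z hz =>
      (differentiableAt_integral_cpow_mul_exp_neg_mul ha hz).differentiableWithinAt) hU
  have hg : AnalyticOnNhd ℂ (fun z : ℂ => (1 / z) ^ a * Complex.Gamma a) {z : ℂ | 0 < z.re} := by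
    refine DifferentiableOn.analyticOnNhd (fun z hz => ?_) hU
    have hz : 0 < z.re := hz
    have hz0 : z ≠ 0 := by rintro rfl; simp at hz
    refine DifferentiableAt.differentiableWithinAt (DifferentiableAt.mul_const ?_ _)
    refine DifferentiableAt.cpow_const (by fun_prop (disch := exact hz0)) (Or.inl ?_)
    rw [one_div, Complex.inv_re]
    exact div_pos hz (Complex.normSq_pos.mpr hz0)
  refine hf.eqOn_of_preconnected_of_frequently_eq hg (convex_halfSpace_re_gt 0).isPreconnected
    (z₀ := ((1 : ℝ) : ℂ)) (by simp) ?_ hr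
  have h1 : Tendsto (fun x : ℝ => (x : ℂ)) (𝓝[≠] 1) (𝓝[≠] ((1 : ℝ) : ℂ)) :=
    (Complex.continuous_ofReal.tendsto 1).inf (by
      simp only [tendsto_principal_principal]
      intro x hx
      simpa using hx)
  refine h1.frequently (Eventually.frequently ?_)
  filter_upwards [nhdsWithin_le_nhds (lt_mem_nhds (zero_lt_one (α := ℝ)))] with x hx
  exact Complex.integral_cpow_mul_exp_neg_mul_Ioi ha hx

/-! ### The kernel, its Taylor expansion at 0, and Mellin transforms of the remainders -/

/-- The kernel `(1 - e^{-t})^{-m}`. -/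
def kernelOne (m : ℕ) (t : ℝ) : ℝ := ((1 - Real.exp (-t))⁻¹) ^ m

lemma one_sub_exp_neg_pos {t : ℝ} (ht : 0 < t) : 0 < 1 - Real.exp (-t) := by
  simpa using ht

lemma kernelOne_continuousOn (m : ℕ) : ContinuousOn (kernelOne m) (Set.Ioi 0) := by
  unfold kernelOne
  refine ContinuousOn.pow (ContinuousOn.inv₀ (by fun_prop) ?_) m
  intro t ht
  exact (one_sub_exp_neg_pos ht).ne'

lemma kernelOne_tendsto_atTop (m : ℕ) : Tendsto (kernelOne m) atTop (𝓝 1) := by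
  have h : Tendsto (fun t : ℝ => Real.exp (-t)) atTop (𝓝 0) :=
    Real.tendsto_exp_neg_atTop_nhds_zero
  have := (((tendsto_const_nhds (x := (1 : ℝ))).sub h).inv₀ (by norm_num)).pow m
  rw [sub_zero, inv_one, one_pow] at this
  exact this

lemma zetaIntegral_one (m : ℕ) (w s : ℂ) :
    zetaIntegral (fun _ : Fin m => (1 : ℝ)) w s = (Complex.Gamma s)⁻¹ *
      mellin (fun t : ℝ => Complex.exp (-(w * t)) * (kernelOne m t : ℂ)) s := by
  unfold zetaIntegral mellin
  congr 1
  refine setIntegral_congr_fun measurableSet_Ioi fun t ht => ?_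
  have ht' : t ^ m ≠ 0 := pow_ne_zero _ (ne_of_gt ht)
  simp only [ruijF, smul_eq_mul, mul_assoc]
  congr 3
  rw [mul_div_cancel_left₀ _ ht']
  simp [kernelOne]

/-- The difference quotient of `1 - e^{-t}` at `0` is analytic with value `1` there, so its inverse
is analytic too. -/
lemma analyticAt_div_one_sub_exp_neg (m : ℕ) :
    ∃ f : ℝ → ℝ, AnalyticAt ℝ f 0 ∧ ∀ t > 0, f t = t ^ m * kernelOne m t := by
  have hE : AnalyticAt ℝ (fun t : ℝ => 1 - Real.exp (-t)) 0 := by fun_prop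
  obtain ⟨p, hp⟩ := hE
  have hd := hp.has_fpower_series_dslope_fslope.analyticAt
  have h0 : dslope (fun t : ℝ => 1 - Real.exp (-t)) 0 0 ≠ 0 := by
    rw [dslope_same]
    have : HasDerivAt (fun t : ℝ => 1 - Real.exp (-t)) 1 0 := by
      have := ((hasDerivAt_neg (0 : ℝ)).exp).const_sub 1
      simpa using this
    rw [this.deriv]
    exact one_ne_zero
  refine ⟨_, (hd.inv h0).pow m, fun t ht => ?_⟩
  simp only [Pi.pow_apply, Pi.inv_apply]
  rw [dslope_of_ne _ (ne_of_gt ht), slope_def_field, kernelOne, ← mul_pow]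
  congr 1
  simp [div_eq_mul_inv, mul_comm]

lemma exists_taylor (m : ℕ) : ∃ c : ℕ → ℝ, ∀ K : ℕ,
    (fun t : ℝ => t ^ m * kernelOne m t - ∑ k ∈ range K, c k * t ^ k)
      =O[𝓝[>] 0] (fun t : ℝ => t ^ K) := by
  obtain ⟨f, ⟨p, hp⟩, hf⟩ := analyticAt_div_one_sub_exp_neg m
  refine ⟨p.coeff, fun K => ?_⟩
  have h := (hp.isBigO_sub_partialSum_pow K).mono (nhdsWithin_le_nhds (s := Set.Ioi 0))
  refine (h.congr' ?_ (.rfl)).trans (IsBigO.of_bound 1 ?_)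
  · filter_upwards [self_mem_nhdsWithin] with t ht
    rw [zero_add, hf t ht, FormalMultilinearSeries.partialSum]
    congr 1
    refine Finset.sum_congr rfl fun k _ => ?_
    rw [FormalMultilinearSeries.apply_eq_pow_smul_coeff, smul_eq_mul, mul_comm]
  · filter_upwards with t
    simp

/-- The Taylor remainder of order `K` of `t^m (1 - e^{-t})^{-m}`, for the coefficients `c`. -/
def taylorRem (m : ℕ) (c : ℕ → ℝ) (K : ℕ) (t : ℝ) : ℝ :=
  t ^ m * kernelOne m t - ∑ k ∈ range K, c k * t ^ k

/-- The sequence `c` consists of the Taylor coefficients of `t^m (1 - e^{-t})^{-m}` at `0`. -/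
def IsTaylor (m : ℕ) (c : ℕ → ℝ) : Prop :=
  ∀ K : ℕ, taylorRem m c K =O[𝓝[>] 0] (fun t : ℝ => t ^ K)

lemma taylorRem_continuousOn (m : ℕ) (c : ℕ → ℝ) (K : ℕ) :
    ContinuousOn (taylorRem m c K) (Set.Ioi 0) :=
  ((continuous_pow m).continuousOn.mul (kernelOne_continuousOn m)).sub (by fun_prop)

lemma taylorRem_isBigO_atTop (m : ℕ) (c : ℕ → ℝ) (K : ℕ) {δ : ℝ} (hδ : 0 < δ) :
    taylorRem m c K =O[atTop] (fun t : ℝ => Real.exp (δ * t)) := by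
  refine IsBigO.sub ?_ (IsBigO.fun_sum fun k _ => ?_)
  · have := (isLittleO_pow_exp_pos_mul_atTop m hδ).isBigO.mul
      ((kernelOne_tendsto_atTop m).isBigO_one ℝ)
    simpa using this
  · exact (isLittleO_pow_exp_pos_mul_atTop k hδ).isBigO.const_mul_left _

lemma exp_neg_mul_isBigO_atTop {w : ℂ} {f : ℝ → ℂ} {δ : ℝ}
    (hf : f =O[atTop] (fun t : ℝ => Real.exp (δ * t))) :
    (fun t : ℝ => Complex.exp (-(w * t)) * f t) =O[atTop]
      (fun t : ℝ => Real.exp (-(w.re - δ) * t)) := by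
  have h1 : (fun t : ℝ => Complex.exp (-(w * t))) =O[atTop]
      (fun t : ℝ => Real.exp (-(w.re * t))) :=
    IsBigO.of_bound 1 (Eventually.of_forall fun t => by simp [Complex.norm_exp])
  refine (h1.mul hf).congr_right fun t => ?_
  rw [← Real.exp_add]
  congr 1
  ring

lemma exp_neg_mul_isBigO_nhdsGT {w : ℂ} {f : ℝ → ℂ} {g : ℝ → ℝ} (hf : f =O[𝓝[>] 0] g) :
    (fun t : ℝ => Complex.exp (-(w * t)) * f t) =O[𝓝[>] 0] g := by
  have h1 : (fun t : ℝ => Complex.exp (-(w * t))) =O[𝓝[>] 0] (fun _ : ℝ => (1 : ℝ)) := by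
    have : Continuous fun t : ℝ => Complex.exp (-(w * t)) := by fun_prop
    exact ((this.tendsto 0).mono_left nhdsWithin_le_nhds).isBigO_one ℝ
  simpa using h1.mul hf

lemma pow_isBigO_rpow_neg (K : ℕ) :
    (fun t : ℝ => t ^ K) =O[𝓝[>] 0] (fun t : ℝ => t ^ (-(-(K : ℝ)))) := by
  simp only [neg_neg, Real.rpow_natCast]
  exact isBigO_refl _ _

section TaylorMellin

variable {m : ℕ} {c : ℕ → ℝ} (hc : IsTaylor m c) {w : ℂ} (hw : 0 < w.re) (K : ℕ)
include hc hw

/-- The remainder is `O(t^K)` at `0`, which opens the half-plane `Re u > -K`; at infinity, half of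
the decay of `e^{-wt}` absorbs its polynomial growth. -/
lemma taylorRem_mellin {u : ℂ} (hu : -(K : ℝ) < u.re) :
    MellinConvergent (fun t : ℝ => Complex.exp (-(w * t)) * (taylorRem m c K t : ℂ)) u ∧
      DifferentiableAt ℂ
        (mellin (fun t : ℝ => Complex.exp (-(w * t)) * (taylorRem m c K t : ℂ))) u := by
  have h1 : LocallyIntegrableOn
      (fun t : ℝ => Complex.exp (-(w * t)) * (taylorRem m c K t : ℂ)) (Set.Ioi 0) := by
    refine ContinuousOn.locallyIntegrableOn ?_ measurableSet_Ioi
    exact ContinuousOn.mul (by fun_prop)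
      (Complex.continuous_ofReal.comp_continuousOn (taylorRem_continuousOn m c K))
  have h2 := exp_neg_mul_isBigO_atTop (w := w)
    (Complex.isBigO_ofReal_left.mpr (taylorRem_isBigO_atTop m c K (half_pos hw)))
  rw [sub_half] at h2
  have h3 := exp_neg_mul_isBigO_nhdsGT (w := w)
    (Complex.isBigO_ofReal_left.mpr ((hc K).trans (pow_isBigO_rpow_neg K)))
  exact ⟨mellinConvergent_of_isBigO_rpow_exp (half_pos hw) h1 h2 h3 hu,
    mellin_differentiableAt_of_isBigO_rpow_exp (half_pos hw) h1 h2 h3 hu⟩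

omit hc in
lemma mellin_exp_neg_mul_pow {u : ℂ} (hu : -(K : ℝ) < u.re) :
    mellin (fun t : ℝ => Complex.exp (-(w * t)) * ((t ^ K : ℝ) : ℂ)) u =
      (1 / w) ^ (u + K) * Complex.Gamma (u + K) := by
  have h := integral_cpow_mul_exp_neg_mul (a := u + K) (r := w)
    (by simp; linarith) hw
  rw [← h, mellin]
  refine setIntegral_congr_fun measurableSet_Ioi fun t ht => ?_
  have ht' : (t : ℂ) ≠ 0 := Complex.ofReal_ne_zero.mpr (ne_of_gt ht)
  simp only [smul_eq_mul, Complex.ofReal_pow]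
  rw [show u + K - 1 = (u - 1) + K by ring, Complex.cpow_add _ _ ht', Complex.cpow_natCast]
  ring

lemma mellin_taylorRem_succ {u : ℂ} (hu : -(K : ℝ) < u.re) :
    mellin (fun t : ℝ => Complex.exp (-(w * t)) * (taylorRem m c (K + 1) t : ℂ)) u =
      mellin (fun t : ℝ => Complex.exp (-(w * t)) * (taylorRem m c K t : ℂ)) u -
        c K * ((1 / w) ^ (u + K) * Complex.Gamma (u + K)) := by
  have h1 := (taylorRem_mellin hc hw K hu).1
  have h2 := (taylorRem_mellin hc hw (K + 1) (u := u) (by push_cast; linarith)).1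
  rw [← mellin_exp_neg_mul_pow hw K hu, ← smul_eq_mul (c K : ℂ), ← mellin_const_smul, mellin,
    mellin, mellin, eq_sub_iff_add_eq]
  have h3 : (fun t : ℝ => (t : ℂ) ^ (u - 1) • ((c K : ℂ) •
      (Complex.exp (-(w * t)) * ((t ^ K : ℝ) : ℂ)))) = fun t : ℝ =>
      (t : ℂ) ^ (u - 1) • (Complex.exp (-(w * t)) * (taylorRem m c K t : ℂ)) -
      (t : ℂ) ^ (u - 1) • (Complex.exp (-(w * t)) * (taylorRem m c (K + 1) t : ℂ)) := by
    funext t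
    simp only [taylorRem, sum_range_succ, smul_eq_mul]
    push_cast
    ring
  rw [h3, integral_sub h1 h2]
  ring

end TaylorMellin

/-! ### Analytic continuation of the Barnes zeta function -/

/-- The rational function that agrees with `Γ(s - m + k) / Γ(s)`. -/
def gammaQuot (m k : ℕ) (s : ℂ) : ℂ :=
  if k < m then ∏ j ∈ range (m - k), (s - 1 - j)⁻¹ else ∏ j ∈ range (k - m), (s + j)

lemma one_div_Gamma_eq_prod (n : ℕ) (s : ℂ) :
    (Complex.Gamma s)⁻¹ = (∏ j ∈ range n, (s + j)) * (Complex.Gamma (s + n))⁻¹ := by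
  induction n with
  | zero => simp
  | succ n ih =>
    rw [ih, prod_range_succ, mul_assoc,
      Complex.one_div_Gamma_eq_self_mul_one_div_Gamma_add_one (s + n)]
    push_cast
    rw [add_assoc]

/-- The functional equation of `Γ`, iterated upwards or downwards according to the sign of `k - m`;
the hypothesis puts `s - m + k` in the right half-plane, where `Γ` does not vanish. -/
lemma inv_Gamma_mul_Gamma (m k : ℕ) {s : ℂ} (hs : (m : ℝ) - k < s.re) :
    (Complex.Gamma s)⁻¹ * Complex.Gamma (s - m + k) = gammaQuot m k s := by
  unfold gammaQuot
  have hG : Complex.Gamma (s - m + k) ≠ 0 :=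
    Complex.Gamma_ne_zero_of_re_pos (by simp; linarith)
  split_ifs with h
  · have h1 := one_div_Gamma_eq_prod (m - k) (s - m + k)
    have h2 : s - m + k + ((m - k : ℕ) : ℂ) = s := by
      rw [Nat.cast_sub h.le]; ring
    rw [h2] at h1
    have h3 : ∏ j ∈ range (m - k), (s - 1 - j)⁻¹ =
        (∏ j ∈ range (m - k), (s - m + k + j))⁻¹ := by
      rw [prod_inv_distrib, ← prod_range_reflect]
      congr 1
      refine prod_congr rfl fun j hj => ?_
      have hj := mem_range.mp hj
      rw [show m - k - 1 - j = m - (k + 1 + j) by omega, Nat.cast_sub (by omega)]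
      push_cast
      ring
    rw [h3]
    have h4 : ∏ j ∈ range (m - k), (s - m + k + j) ≠ 0 := by
      intro h0
      rw [h0, zero_mul] at h1
      exact inv_ne_zero hG h1
    have h5 : (Complex.Gamma s)⁻¹ ≠ 0 := by
      intro h0
      rw [h0, mul_zero] at h1
      exact inv_ne_zero hG h1
    rw [← mul_eq_one_iff_eq_inv₀ h4, mul_right_comm, mul_comm (Complex.Gamma s)⁻¹, ← h1,
      inv_mul_cancel₀ hG]
  · push Not at h
    have h2 : s - m + k = s + ((k - m : ℕ) : ℂ) := by
      rw [Nat.cast_sub h]; ring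
    rw [h2] at hG ⊢
    rw [one_div_Gamma_eq_prod (k - m) s, mul_assoc, inv_mul_cancel₀ hG, mul_one]

lemma gammaQuot_differentiableAt (m k : ℕ) {s : ℂ} (hs : ∀ j ∈ Icc 1 m, s ≠ (j : ℂ)) :
    DifferentiableAt ℂ (gammaQuot m k) s := by
  unfold gammaQuot
  split_ifs with h
  · refine DifferentiableAt.fun_finsetProd fun j hj => ?_
    refine DifferentiableAt.inv (by fun_prop) ?_
    have hj := mem_range.mp hj
    have := hs (j + 1) (mem_Icc.mpr ⟨by omega, by omega⟩)
    intro h0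
    apply this
    push_cast
    linear_combination h0
  · exact DifferentiableAt.fun_finsetProd fun j hj => by fun_prop

/-- The continuation of the Barnes zeta function to `Re s > m - K`. -/
def zetaStrip (m : ℕ) (c : ℕ → ℝ) (w : ℂ) (K : ℕ) (s : ℂ) : ℂ :=
  ∑ k ∈ range K, c k * gammaQuot m k s * (1 / w) ^ (s - m + k) +
    (Complex.Gamma s)⁻¹ *
      mellin (fun t : ℝ => Complex.exp (-(w * t)) * (taylorRem m c K t : ℂ)) (s - m)

section Strip

variable {m : ℕ} {c : ℕ → ℝ} (hc : IsTaylor m c) {w : ℂ} (hw : 0 < w.re)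
include hc hw

/-- Raising `K` only moves one Taylor term out of the Mellin integral, where it becomes an explicit
Gamma integral. -/
lemma zetaStrip_succ (K : ℕ) {s : ℂ} (hs : (m : ℝ) - K < s.re) :
    zetaStrip m c w (K + 1) s = zetaStrip m c w K s := by
  unfold zetaStrip
  rw [sum_range_succ, mellin_taylorRem_succ hc hw K (by simp; linarith),
    ← inv_Gamma_mul_Gamma m K hs]
  ring

lemma zetaStrip_eq_of_le {K K' : ℕ} (h : K ≤ K') {s : ℂ} (hs : (m : ℝ) - K < s.re) :
    zetaStrip m c w K' s = zetaStrip m c w K s := by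
  induction K', h using Nat.le_induction with
  | base => rfl
  | succ n hn ih =>
    have : (K : ℝ) ≤ n := by exact_mod_cast hn
    rw [zetaStrip_succ hc hw n (by linarith), ih]

lemma zetaStrip_eq {K K' : ℕ} {s : ℂ} (hs : (m : ℝ) - K < s.re) (hs' : (m : ℝ) - K' < s.re) :
    zetaStrip m c w K' s = zetaStrip m c w K s := by
  rcases le_total K K' with h | h
  · exact zetaStrip_eq_of_le hc hw h hs
  · exact (zetaStrip_eq_of_le hc hw h hs').symm

lemma zetaStrip_differentiableAt (K : ℕ) {s : ℂ} (hs : (m : ℝ) - K < s.re)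
    (hs' : ∀ j ∈ Icc 1 m, s ≠ (j : ℂ)) : DifferentiableAt ℂ (zetaStrip m c w K) s := by
  have hw0 : (1 / w) ≠ 0 := by
    refine one_div_ne_zero ?_
    rintro rfl
    simp at hw
  unfold zetaStrip
  refine DifferentiableAt.add (DifferentiableAt.fun_sum fun k _ => ?_) ?_
  · exact ((gammaQuot_differentiableAt m k hs').const_mul _).mul
      (DifferentiableAt.const_cpow (by fun_prop) (Or.inl hw0))
  · refine (Complex.differentiable_one_div_Gamma s).mul ?_
    have := (taylorRem_mellin hc hw K (u := s - m) (by simp; linarith)).2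
    exact this.comp s (f := fun s : ℂ => s - m) (by fun_prop)

end Strip

lemma zetaStrip_zero (m : ℕ) (c : ℕ → ℝ) (w s : ℂ) :
    zetaStrip m c w 0 s = zetaIntegral (fun _ : Fin m => (1 : ℝ)) w s := by
  rw [zetaIntegral_one, zetaStrip, range_zero, sum_empty, zero_add]
  have := mellin_cpow_smul
    (fun t : ℝ => Complex.exp (-(w * t)) * (kernelOne m t : ℂ)) (s - m) m
  rw [sub_add_cancel] at this
  rw [← this]
  congr 2
  funext t
  simp [taylorRem]
  ring

theorem exists_isZetaContinuation (m : ℕ) {w : ℂ} (hw : 0 < w.re) :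
    ∃ Z, IsZetaContinuation (fun _ : Fin m => (1 : ℝ)) w Z := by
  obtain ⟨c, hc⟩ := exists_taylor m
  have hc : IsTaylor m c := hc
  have key : ∀ s : ℂ, (m : ℝ) - (⌈(m : ℝ) - s.re⌉₊ + 1 : ℕ) < s.re := fun s => by
    have := Nat.le_ceil ((m : ℝ) - s.re)
    push_cast
    linarith
  refine ⟨fun s => zetaStrip m c w (⌈(m : ℝ) - s.re⌉₊ + 1) s, ?_, fun s hs => ?_⟩
  · intro s hs
    refine DifferentiableAt.differentiableWithinAt ?_
    -- The order used in the definition jumps with `s`; near a given point it may be frozen, since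
    -- all admissible orders give the same value.
    set K := ⌈(m : ℝ) - s.re⌉₊ + 1 with hK
    refine (zetaStrip_differentiableAt hc hw K (key s) hs).congr_of_eventuallyEq ?_
    have : ∀ᶠ z : ℂ in 𝓝 s, (m : ℝ) - K < z.re :=
      Complex.continuous_re.continuousAt.eventually (lt_mem_nhds (key s))
    filter_upwards [this] with z hz
    exact zetaStrip_eq hc hw hz (key z)
  · rw [← zetaStrip_zero m c]
    exact zetaStrip_eq hc hw (by simpa using hs) (key s)

lemma zeta_isZetaContinuation (m : ℕ) {w : ℂ} (hw : 0 < w.re) :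
    IsZetaContinuation (fun _ : Fin m => (1 : ℝ)) w (zeta (fun _ : Fin m => (1 : ℝ)) w) := by
  have h := exists_isZetaContinuation m hw
  rw [zeta, dif_pos h]
  exact h.choose_spec

lemma kernelOne_isBigO_nhdsGT (m : ℕ) :
    kernelOne m =O[𝓝[>] 0] (fun t : ℝ => t ^ (-(m : ℝ))) := by
  obtain ⟨f, hf, hft⟩ := analyticAt_div_one_sub_exp_neg m
  have h1 : f =O[𝓝[>] 0] (fun _ : ℝ => (1 : ℝ)) :=
    (hf.continuousAt.tendsto.mono_left nhdsWithin_le_nhds).isBigO_one ℝ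
  have h2 := h1.mul (isBigO_refl (fun t : ℝ => t ^ (-(m : ℝ))) (𝓝[>] 0))
  refine h2.congr' ?_ (by simp)
  filter_upwards [self_mem_nhdsWithin] with t ht
  rw [hft t ht, Real.rpow_neg (le_of_lt ht), Real.rpow_natCast]
  have : t ^ m ≠ 0 := pow_ne_zero _ (ne_of_gt ht)
  field_simp

lemma kernelOne_mellinConvergent (m : ℕ) {w : ℂ} (hw : 0 < w.re) {s : ℂ} (hs : (m : ℝ) < s.re) :
    MellinConvergent (fun t : ℝ => Complex.exp (-(w * t)) * (kernelOne m t : ℂ)) s := by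
  have h2 := exp_neg_mul_isBigO_atTop (w := w) (δ := 0) (f := fun t => (kernelOne m t : ℂ))
    (Complex.isBigO_ofReal_left.mpr
      (by simpa using (kernelOne_tendsto_atTop m).isBigO_one ℝ))
  rw [sub_zero] at h2
  have h3 := exp_neg_mul_isBigO_nhdsGT (w := w)
    (Complex.isBigO_ofReal_left.mpr (kernelOne_isBigO_nhdsGT m))
  refine mellinConvergent_of_isBigO_rpow_exp hw ?_ h2 h3 hs
  refine ContinuousOn.locallyIntegrableOn ?_ measurableSet_Ioi
  exact ContinuousOn.mul (by fun_prop)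
      (Complex.continuous_ofReal.comp_continuousOn (kernelOne_continuousOn m))

/-! ### Identities for the log-gamma functions by analytic continuation to `s = 0` -/

/-- A connected neighbourhood of `0` that avoids the positive integers, contains points of
arbitrarily large real part, and lies to the right of `-1`. -/
def zeroRegion : Set ℂ := {s : ℂ | -1 < s.re ∧ 0 < s.im} ∪ Metric.ball 0 1

lemma isOpen_zeroRegion : IsOpen zeroRegion := by
  refine IsOpen.union ?_ Metric.isOpen_ball
  exact (isOpen_lt continuous_const Complex.continuous_re).inter
    (isOpen_lt continuous_const Complex.continuous_im)

lemma zero_mem_zeroRegion : (0 : ℂ) ∈ zeroRegion := Or.inr (by simp)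

lemma isPreconnected_zeroRegion : IsPreconnected zeroRegion := by
  refine IsPreconnected.union ((1 / 2 : ℝ) * Complex.I) ?_ ?_ ?_ ?_
  · simp
  · simp; norm_num
  · exact ((convex_halfSpace_re_gt (-1)).inter (convex_halfSpace_im_gt 0)).isPreconnected
  · exact (convex_ball (0 : ℂ) 1).isPreconnected

lemma neg_one_lt_re_of_mem_zeroRegion {s : ℂ} (hs : s ∈ zeroRegion) : -1 < s.re := by
  rcases hs with hs | hs
  · exact hs.1
  · have := (Complex.abs_re_le_norm s).trans_lt (by simpa using hs)
    exact (abs_lt.mp this).1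

lemma ne_natCast_of_mem_zeroRegion (m : ℕ) {s : ℂ} (hs : s ∈ zeroRegion) :
    ∀ k ∈ Finset.Icc 1 m, s ≠ (k : ℂ) := by
  rintro k hk rfl
  have hk1 : 1 ≤ k := (mem_Icc.mp hk).1
  rcases hs with hs | hs
  · simpa using hs.2
  · have : (k : ℝ) < 1 := by simpa using hs
    have : k < 1 := by exact_mod_cast this
    omega

theorem deriv_zero_eq_of_eq_right {f g : ℂ → ℂ} (hf : DifferentiableOn ℂ f zeroRegion)
    (hg : DifferentiableOn ℂ g zeroRegion) {x : ℝ} (hx : 0 ≤ x)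
    (h : ∀ s : ℂ, x < s.re → f s = g s) : deriv f 0 = deriv g 0 := by
  -- A point of the region inside the half-plane of agreement; the identity theorem starts here and
  -- reaches `0`.
  have hz : ((x + 1 : ℝ) + Complex.I : ℂ) ∈ zeroRegion := Or.inl (by simp; linarith)
  have he : f =ᶠ[𝓝 ((x + 1 : ℝ) + Complex.I : ℂ)] g := by
    filter_upwards [Complex.continuous_re.continuousAt.eventually
      (lt_mem_nhds (show x < ((x + 1 : ℝ) + Complex.I : ℂ).re by simp))] with s hs
    exact h s hs
  have := (hf.analyticOnNhd isOpen_zeroRegion).eqOn_of_preconnected_of_eventuallyEq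
    (hg.analyticOnNhd isOpen_zeroRegion) isPreconnected_zeroRegion hz he
  exact (this.eventuallyEq_of_mem (isOpen_zeroRegion.mem_nhds zero_mem_zeroRegion)).deriv_eq

section

variable (m : ℕ) {w : ℂ} (hw : 0 < w.re)
include hw

lemma zeta_differentiableOn_zeroRegion :
    DifferentiableOn ℂ (zeta (fun _ : Fin m => (1 : ℝ)) w) zeroRegion :=
  (zeta_isZetaContinuation m hw).differentiableOn.mono
    fun _ hs => ne_natCast_of_mem_zeroRegion m hs

lemma zeta_differentiableAt_zero :
    DifferentiableAt ℂ (zeta (fun _ : Fin m => (1 : ℝ)) w) 0 :=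
  (zeta_differentiableOn_zeroRegion m hw).differentiableAt
    (isOpen_zeroRegion.mem_nhds zero_mem_zeroRegion)

lemma zeta_eq_mellin {s : ℂ} (hs : (m : ℝ) < s.re) :
    zeta (fun _ : Fin m => (1 : ℝ)) w s = (Complex.Gamma s)⁻¹ *
      mellin (fun t : ℝ => Complex.exp (-(w * t)) * (kernelOne m t : ℂ)) s := by
  rw [(zeta_isZetaContinuation m hw).eq_integral s hs, zetaIntegral_one]

/-- For `m = 0` the integral is a plain Gamma integral, so the zeta function is `(1/w)^s`. -/
theorem logGamma_zero : logGamma (fun _ : Fin 0 => (1 : ℝ)) w = -Complex.log w := by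
  have hw0 : w ≠ 0 := by rintro rfl; simp at hw
  have h : HasDerivAt (fun s : ℂ => (1 / w) ^ s) ((1 / w) ^ (0 : ℂ) * Complex.log (1 / w) * 1) 0 :=
    (hasDerivAt_id (0 : ℂ)).const_cpow (Or.inl (one_div_ne_zero hw0))
  rw [logGamma, deriv_zero_eq_of_eq_right (zeta_differentiableOn_zeroRegion 0 hw)
    (g := fun s : ℂ => (1 / w) ^ s) ?_ le_rfl ?_, h.deriv]
  · rw [Complex.cpow_zero, one_div, Complex.log_inv]
    · ring
    · intro harg
      have := Complex.abs_arg_lt_pi_div_two_iff.mpr (Or.inl hw)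
      rw [harg, abs_of_pos Real.pi_pos] at this
      linarith [Real.pi_pos]
  · exact fun s _ => (DifferentiableAt.const_cpow (by fun_prop)
      (Or.inl (one_div_ne_zero hw0))).differentiableWithinAt
  · intro s hs
    have h1 := mellin_exp_neg_mul_pow hw 0 (u := s) (by simpa using hs)
    have h2 : (fun t : ℝ => Complex.exp (-(w * t)) * (kernelOne 0 t : ℂ)) =
        fun t : ℝ => Complex.exp (-(w * t)) * ((t ^ 0 : ℝ) : ℂ) := by
      simp [kernelOne]
    rw [zeta_eq_mellin 0 hw (by simpa using hs), h2, h1, Nat.cast_zero, add_zero, mul_comm,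
      mul_assoc, mul_inv_cancel₀ (Complex.Gamma_ne_zero_of_re_pos hs), mul_one]

theorem logGamma_add_one :
    logGamma (fun _ : Fin (m + 1) => (1 : ℝ)) (w + 1) =
      logGamma (fun _ : Fin (m + 1) => (1 : ℝ)) w - logGamma (fun _ : Fin m => (1 : ℝ)) w := by
  have hw1 : 0 < (w + 1).re := by simp; linarith
  have h := deriv_zero_eq_of_eq_right
    ((zeta_differentiableOn_zeroRegion (m + 1) hw).sub
      (zeta_differentiableOn_zeroRegion m hw))
    (zeta_differentiableOn_zeroRegion (m + 1) hw1) (x := (m + 1 : ℕ)) (by positivity) ?_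
  · rw [deriv_sub (zeta_differentiableAt_zero _ hw) (zeta_differentiableAt_zero _ hw)] at h
    exact h.symm
  · intro s hs
    have hs' : (m : ℝ) < s.re := by push_cast at hs; linarith
    rw [Pi.sub_apply, zeta_eq_mellin _ hw hs, zeta_eq_mellin _ hw1 hs, zeta_eq_mellin _ hw hs',
      ← mul_sub]
    congr 1
    rw [mellin, mellin, mellin, ← integral_sub (kernelOne_mellinConvergent _ hw hs)
      (kernelOne_mellinConvergent _ hw hs')]
    refine setIntegral_congr_fun measurableSet_Ioi fun t ht => ?_
    -- The source of the recurrence: shifting `w` by `1` multiplies the integrand by `e^{-t} = 1 -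
    -- (1 - e^{-t})`.
    have h1 : kernelOne (m + 1) t * Real.exp (-t) = kernelOne (m + 1) t - kernelOne m t := by
      have := (one_sub_exp_neg_pos ht).ne'
      simp only [kernelOne, pow_succ]
      field_simp
      ring
    have h2 : (kernelOne (m + 1) t : ℂ) * Complex.exp (-t) =
        kernelOne (m + 1) t - kernelOne m t := by exact_mod_cast h1
    simp only [smul_eq_mul]
    rw [add_mul, one_mul, neg_add, Complex.exp_add, mul_assoc, mul_comm (Complex.exp (-t)), h2]
    ring

end

/-! ### Integral formula for linear combinations of log-gamma values -/

/-- A linear combination of exponentials `e^{-w_i t}`, divided by `(1 - e^{-t})^m`. -/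
def expSum {ι : Type*} (S : Finset ι) (α w : ι → ℂ) (m : ℕ) (t : ℝ) : ℂ :=
  ∑ i ∈ S, α i * (Complex.exp (-(w i * t)) * (kernelOne m t : ℂ))

section

variable {ι : Type*} (S : Finset ι) (α w : ι → ℂ) (m : ℕ) {δ : ℝ} (hδ : 0 < δ)
  (hw : ∀ i ∈ S, δ ≤ (w i).re)
  (hO : expSum S α w m =O[𝓝[>] 0] (fun t : ℝ => t))
include hδ hw hO

lemma expSum_mellin {s : ℂ} (hs : -1 < s.re) :
    MellinConvergent (expSum S α w m) s ∧ DifferentiableAt ℂ (mellin (expSum S α w m)) s := by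
  have h1 : LocallyIntegrableOn (expSum S α w m) (Set.Ioi 0) := by
    refine ContinuousOn.locallyIntegrableOn ?_ measurableSet_Ioi
    unfold expSum
    refine continuousOn_finsetSum _ fun i _ => ?_
    exact continuousOn_const.mul (ContinuousOn.mul (by fun_prop)
      (Complex.continuous_ofReal.comp_continuousOn (kernelOne_continuousOn m)))
  have h2 : expSum S α w m =O[atTop] (fun t : ℝ => Real.exp (-δ * t)) := by
    unfold expSum
    refine IsBigO.fun_sum fun i hi => IsBigO.const_mul_left ?_ _
    have h2 := exp_neg_mul_isBigO_atTop (w := w i) (δ := 0) (f := fun t => (kernelOne m t : ℂ))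
      (Complex.isBigO_ofReal_left.mpr
        (by simpa using (kernelOne_tendsto_atTop m).isBigO_one ℝ))
    refine h2.trans (IsBigO.of_bound 1 ?_)
    filter_upwards [eventually_ge_atTop 0] with t ht
    rw [one_mul, Real.norm_of_nonneg (Real.exp_nonneg _), Real.norm_of_nonneg (Real.exp_nonneg _)]
    refine Real.exp_le_exp.mpr ?_
    nlinarith [hw i hi]
  have h3 : expSum S α w m =O[𝓝[>] 0] (fun t : ℝ => t ^ (-(-1 : ℝ))) := by
    simpa using hO
  exact ⟨mellinConvergent_of_isBigO_rpow_exp hδ h1 h2 h3 hs,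
    mellin_differentiableAt_of_isBigO_rpow_exp hδ h1 h2 h3 hs⟩

/-- Because the combination is `O(t)` at `0`, its Mellin transform `F` is holomorphic at `s = 0`. As
`1/Γ(s) = s/Γ(s+1)`, the derivative of `F(s)/Γ(s)` at `0` is just `F(0)`. -/
theorem sum_logGamma_eq_integral :
    IntegrableOn (fun t : ℝ => expSum S α w m t / t) (Set.Ioi 0) ∧
    ∑ i ∈ S, α i * logGamma (fun _ : Fin m => (1 : ℝ)) (w i) =
      ∫ t in Set.Ioi (0 : ℝ), expSum S α w m t / t := by
  have e : (fun t : ℝ => (t : ℂ) ^ ((0 : ℂ) - 1) • expSum S α w m t) =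
      fun t : ℝ => expSum S α w m t / t := by
    funext t
    rw [zero_sub, Complex.cpow_neg_one, smul_eq_mul, mul_comm, div_eq_mul_inv]
  have hM {s : ℂ} (hs : -1 < s.re) := expSum_mellin S α w m hδ hw hO hs
  refine ⟨?_, ?_⟩
  · have := (hM (s := 0) (by simp)).1
    rwa [MellinConvergent, e] at this
  have hH : HasDerivAt (fun s : ℂ => (Complex.Gamma s)⁻¹ * mellin (expSum S α w m) s)
      (mellin (expSum S α w m) 0) 0 := by
    have h1 : DifferentiableAt ℂ
        (fun s : ℂ => (Complex.Gamma (s + 1))⁻¹ * mellin (expSum S α w m) s) 0 := by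
      refine DifferentiableAt.mul ?_ (hM (by simp)).2
      exact (Complex.differentiable_one_div_Gamma (0 + 1)).comp (0 : ℂ) (f := fun s : ℂ => s + 1)
        (by fun_prop)
    have h2 := (hasDerivAt_id (0 : ℂ)).fun_mul h1.hasDerivAt
    refine (h2.congr_deriv (by simp)).congr_of_eventuallyEq (Eventually.of_forall fun s => ?_)
    simp only [id]
    rw [Complex.one_div_Gamma_eq_self_mul_one_div_Gamma_add_one, mul_assoc]
  have hd : deriv (fun s : ℂ => ∑ i ∈ S, α i * zeta (fun _ : Fin m => (1 : ℝ)) (w i) s) 0 =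
      ∑ i ∈ S, α i * logGamma (fun _ : Fin m => (1 : ℝ)) (w i) := by
    rw [deriv_fun_sum fun i hi =>
      (zeta_differentiableAt_zero m (hδ.trans_le (hw i hi))).const_mul _]
    exact sum_congr rfl fun i hi =>
      deriv_const_mul _ (zeta_differentiableAt_zero m (hδ.trans_le (hw i hi)))
  rw [← hd, deriv_zero_eq_of_eq_right (x := m) ?_ ?_ (by positivity) ?_, hH.deriv, mellin, e]
  · exact DifferentiableOn.fun_sum fun i hi =>
      (zeta_differentiableOn_zeroRegion m (hδ.trans_le (hw i hi))).const_mul _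
  · intro s hs
    exact ((Complex.differentiable_one_div_Gamma s).mul
      (hM (neg_one_lt_re_of_mem_zeroRegion hs)).2).differentiableWithinAt
  · intro s hs
    have hc := fun i hi => kernelOne_mellinConvergent m (hδ.trans_le (hw i hi)) hs
    have h3 : mellin (expSum S α w m) s = ∑ i ∈ S, α i *
        mellin (fun t : ℝ => Complex.exp (-(w i * t)) * (kernelOne m t : ℂ)) s := by
      simp_rw [← smul_eq_mul (α _), ← mellin_const_smul, mellin]
      rw [← integral_finsetSum _ fun i hi => (hc i hi).const_smul (α i)]
      refine integral_congr_ae (Eventually.of_forall fun t => ?_)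
      simp only [expSum, smul_eq_mul, mul_sum]
    rw [h3, mul_sum]
    refine sum_congr rfl fun i hi => ?_
    rw [zeta_eq_mellin m (hδ.trans_le (hw i hi)) hs]
    ring

end

/-! ### Laplace transforms: convolution, compound Poisson and Gamma laws -/

/-- The measure `ρ` lives on `[0, ∞)` and its Laplace transform is finite and equal to `φ` on
`Re q > x`. -/
structure IsLaplace (ρ : Measure ℝ) (x : ℝ) (φ : ℂ → ℂ) : Prop where
  nonneg : ∀ᵐ t ∂ρ, 0 ≤ t
  integrable : ∀ q : ℂ, x < q.re → Integrable (fun t : ℝ => Complex.exp (-(q * t))) ρ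
  integral_eq : ∀ q : ℂ, x < q.re → ∫ t : ℝ, Complex.exp (-(q * t)) ∂ρ = φ q

namespace IsLaplace

variable {ρ ρ' : Measure ℝ} {x : ℝ} {φ φ' : ℂ → ℂ}

lemma isFiniteMeasure (h : IsLaplace ρ x φ) (hx : x < 0) : IsFiniteMeasure ρ := by
  have := h.integrable 0 (by simpa using hx)
  simpa [integrable_const_iff] using this

lemma isProbabilityMeasure (h : IsLaplace ρ x φ) (hx : x < 0) (h0 : φ 0 = 1) :
    IsProbabilityMeasure ρ := by
  have := h.isFiniteMeasure hx
  have h1 := h.integral_eq 0 (by simpa using hx)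
  rw [h0] at h1
  have h2 : ρ.real Set.univ = 1 := by
    have : ((ρ.real Set.univ : ℝ) : ℂ) = 1 := by simpa using h1
    exact_mod_cast this
  exact ⟨by rwa [Measure.real, ENNReal.toReal_eq_one_iff] at h2⟩

lemma congr (h : IsLaplace ρ x φ) (hφ : ∀ q : ℂ, x < q.re → φ q = φ' q) : IsLaplace ρ x φ' :=
  ⟨h.nonneg, h.integrable, fun q hq => (h.integral_eq q hq).trans (hφ q hq)⟩

lemma dirac_zero (x : ℝ) : IsLaplace (Measure.dirac 0) x 1 where
  nonneg := by simp [ae_dirac_eq]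
  integrable q _ := integrable_dirac (by simp)
  integral_eq q _ := by simp

lemma conv (hx : x < 0) (h : IsLaplace ρ x φ) (h' : IsLaplace ρ' x φ') :
    IsLaplace (ρ.conv ρ') x (φ * φ') := by
  have := h.isFiniteMeasure hx
  have := h'.isFiniteMeasure hx
  have hm : AEMeasurable (fun p : ℝ × ℝ => p.1 + p.2) (ρ.prod ρ') := by fun_prop
  have hf (q : ℂ) (ν : Measure ℝ) :
      AEStronglyMeasurable (fun t : ℝ => Complex.exp (-(q * t))) ν :=
    Continuous.aestronglyMeasurable (by fun_prop)
  have hadd (q : ℂ) (p : ℝ × ℝ) : Complex.exp (-(q * (p.1 + p.2 : ℝ))) =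
      Complex.exp (-(q * p.1)) * Complex.exp (-(q * p.2)) := by
    rw [← Complex.exp_add]
    congr 1
    push_cast
    ring
  refine ⟨?_, fun q hq => ?_, fun q hq => ?_⟩
  · rw [Measure.conv, ae_map_iff hm measurableSet_Ici]
    filter_upwards [Measure.quasiMeasurePreserving_fst.ae h.nonneg,
      Measure.quasiMeasurePreserving_snd.ae h'.nonneg] with p h1 h2 using add_nonneg h1 h2
  · rw [Measure.conv, integrable_map_measure (hf q _) hm]
    refine ((h.integrable q hq).mul_prod (h'.integrable q hq)).congr ?_
    exact Eventually.of_forall fun p => (hadd q p).symm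
  · rw [Measure.conv, integral_map hm (hf q _), Pi.mul_apply, ← h.integral_eq q hq,
      ← h'.integral_eq q hq, ← integral_prod_mul]
    exact integral_congr_ae (Eventually.of_forall fun p => hadd q p)

lemma exists_pow (hx : x < 0) (h : IsLaplace ρ x φ) (n : ℕ) :
    ∃ ρ' : Measure ℝ, IsLaplace ρ' x (φ ^ n) := by
  induction n with
  | zero => exact ⟨_, by simpa using dirac_zero x⟩
  | succ n ih =>
    obtain ⟨ρ', h'⟩ := ih
    exact ⟨_, by simpa [pow_succ] using conv hx h' h⟩

lemma integral_norm (h : IsLaplace ρ x φ) {q : ℂ} (hq : x < q.re) :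
    ((∫ t : ℝ, ‖Complex.exp (-(q * t))‖ ∂ρ : ℝ) : ℂ) = φ q.re := by
  rw [← h.integral_eq q.re (by simpa using hq), ← integral_complex_ofReal]
  refine integral_congr_ae (Eventually.of_forall fun t => ?_)
  simp [Complex.norm_exp]

/-- Existence of compound Poisson distributions. -/
theorem exists_exp (hx : x < 0) (h : IsLaplace ρ x φ) :
    ∃ ρ' : Measure ℝ, IsLaplace ρ' x (fun q => Complex.exp (φ q - φ 0)) := by
  have := h.isFiniteMeasure hx
  set L := ρ.real Set.univ with hL
  have hφ0 : φ 0 = (L : ℂ) := by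
    rw [← h.integral_eq 0 (by simpa using hx)]
    simp [hL]
  choose σ hσ using exists_pow hx h
  have hcpos (n : ℕ) : 0 ≤ Real.exp (-L) / n.factorial := by positivity
  -- Poisson weights without the factor `L^n`, which is already the total mass of the convolution
  -- power `σ n`.
  let c : ℕ → ENNReal := fun n => ENNReal.ofReal (Real.exp (-L) / n.factorial)
  have hcr (n : ℕ) : (c n).toReal = Real.exp (-L) / n.factorial := ENNReal.toReal_ofReal (hcpos n)
  have hi (q : ℂ) (hq : x < q.re) :
      Integrable (fun t : ℝ => Complex.exp (-(q * t))) (Measure.sum fun n => c n • σ n) := by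
    refine integrable_sum_measure
      (fun n => ((hσ n).integrable q hq).smul_measure ENNReal.ofReal_ne_top) ?_
    have h1 (n : ℕ) : ∫ t : ℝ, ‖Complex.exp (-(q * t))‖ ∂(c n • σ n) =
        Real.exp (-L) * ((∫ t : ℝ, ‖Complex.exp (-(q * t))‖ ∂ρ) ^ n / n.factorial) := by
      have h2 : ∫ t : ℝ, ‖Complex.exp (-(q * t))‖ ∂(σ n) =
          (∫ t : ℝ, ‖Complex.exp (-(q * t))‖ ∂ρ) ^ n := by
        have := (hσ n).integral_norm hq
        rw [Pi.pow_apply, ← h.integral_norm hq] at this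
        exact_mod_cast this
      rw [integral_smul_measure, hcr, h2, smul_eq_mul]
      ring
    simp_rw [h1]
    exact (Real.summable_pow_div_factorial _).mul_left _
  refine ⟨Measure.sum fun n => c n • σ n, ?_, hi, fun q hq => ?_⟩
  · rw [Measure.ae_sum_iff]
    exact fun n => Measure.ae_smul_measure (hσ n).nonneg _
  · refine (hasSum_integral_measure (hi q hq)).unique ?_
    have h1 (n : ℕ) : ∫ t : ℝ, Complex.exp (-(q * t)) ∂(c n • σ n) =
        Complex.exp (-L) * (φ q ^ n / n.factorial) := by
      rw [integral_smul_measure, hcr, (hσ n).integral_eq q hq, Complex.real_smul, Pi.pow_apply]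
      push_cast
      ring
    simp_rw [h1]
    rw [hφ0, sub_eq_neg_add, Complex.exp_add]
    refine HasSum.mul_left _ ?_
    have := NormedSpace.expSeries_div_hasSum_exp (φ q)
    rwa [← Complex.exp_eq_exp_ℂ] at this

theorem of_density {k : ℝ → ℝ} (hk : Measurable k) (hk0 : ∀ t > 0, 0 ≤ k t)
    (hi : ∀ q : ℂ, x < q.re →
      IntegrableOn (fun t : ℝ => k t * Complex.exp (-(q * t))) (Set.Ioi 0)) :
    ∃ ρ : Measure ℝ,
      IsLaplace ρ x (fun q => ∫ t in Set.Ioi (0 : ℝ), k t * Complex.exp (-(q * t))) := by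
  have hm : Measurable fun t => ENNReal.ofReal (k t) := hk.ennreal_ofReal
  have hfin : ∀ᵐ t ∂(volume.restrict (Set.Ioi (0 : ℝ))), ENNReal.ofReal (k t) < ⊤ :=
    Eventually.of_forall fun t => ENNReal.ofReal_lt_top
  have he (q : ℂ) : (fun t : ℝ => (ENNReal.ofReal (k t)).toReal • Complex.exp (-(q * t)))
      =ᵐ[volume.restrict (Set.Ioi (0 : ℝ))] (fun t : ℝ => k t * Complex.exp (-(q * t))) := by
    filter_upwards [ae_restrict_mem measurableSet_Ioi] with t ht
    rw [ENNReal.toReal_ofReal (hk0 t ht), Complex.real_smul]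
  refine ⟨(volume.restrict (Set.Ioi 0)).withDensity fun t => ENNReal.ofReal (k t), ?_,
    fun q hq => ?_, fun q hq => ?_⟩
  · refine (withDensity_absolutelyContinuous _ _).ae_le ?_
    filter_upwards [ae_restrict_mem measurableSet_Ioi] with t ht using le_of_lt ht
  · rw [integrable_withDensity_iff_integrable_smul' hm hfin]
    exact (hi q hq).congr (he q).symm
  · rw [integral_withDensity_eq_integral_toReal_smul hm hfin]
    exact integral_congr_ae (he q)

/-- The Laplace transform of the Gamma distribution of shape `c` and rate `r`. -/
theorem exists_gamma {c r : ℝ} (hc : 0 ≤ c) (hr : 0 < r) (hx : -r ≤ x) :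
    ∃ ρ : Measure ℝ, IsLaplace ρ x
      (fun q => Complex.exp (c * (Complex.log r - Complex.log (r + q)))) := by
  -- Shape `0` is the point mass at `0`; it occurs when `M < N`, where no Gamma part is needed.
  rcases hc.eq_or_lt with rfl | hc
  · exact ⟨_, (dirac_zero x).congr fun q _ => by simp⟩
  have key (q : ℂ) (t : ℝ) (ht : 0 < t) :
      ((r ^ c / Real.Gamma c * t ^ (c - 1) * Real.exp (-(r * t)) : ℝ) : ℂ) *
        Complex.exp (-(q * t)) = ((r ^ c / Real.Gamma c : ℝ) : ℂ) *
          ((t : ℂ) ^ ((c : ℂ) - 1) * Complex.exp (-((r + q) * t))) := by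
    rw [add_mul, neg_add, Complex.exp_add, ← Complex.ofReal_one, ← Complex.ofReal_sub,
      ← Complex.ofReal_cpow ht.le]
    push_cast
    ring
  have hre (q : ℂ) (hq : x < q.re) : 0 < (r + q).re := by simp; linarith
  obtain ⟨ρ, hρ⟩ := of_density (x := x)
    (k := fun t => r ^ c / Real.Gamma c * t ^ (c - 1) * Real.exp (-(r * t)))
    (by fun_prop) (fun t ht => by have := Real.Gamma_pos_of_pos hc; positivity) (fun q hq => by
      refine IntegrableOn.congr_fun ?_ (fun t ht => (key q t ht).symm) measurableSet_Ioi
      exact (integrableOn_cpow_mul_exp_neg_mul (by simpa using hc) (hre q hq)).const_mul _)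
  refine ⟨ρ, hρ.congr fun q hq => ?_⟩
  have hr0 : (r : ℂ) ≠ 0 := by exact_mod_cast hr.ne'
  have hq0 : (r + q : ℂ) ≠ 0 := by
    intro h
    have := hre q hq
    rw [h] at this
    simp at this
  have hG : Complex.Gamma c ≠ 0 := Complex.Gamma_ne_zero_of_re_pos (by simpa using hc)
  rw [setIntegral_congr_fun measurableSet_Ioi (key q), integral_const_mul,
    integral_cpow_mul_exp_neg_mul (by simpa using hc) (hre q hq), Complex.ofReal_div,
    Complex.ofReal_cpow hr.le, ← Complex.Gamma_ofReal, one_div, Complex.inv_cpow,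
    Complex.cpow_def_of_ne_zero hr0, Complex.cpow_def_of_ne_zero hq0, mul_sub, Complex.exp_sub,
    mul_comm (c : ℂ), mul_comm (c : ℂ)]
  · field_simp
  · intro harg
    have := Complex.abs_arg_lt_pi_div_two_iff.mpr (Or.inl (hre q hq))
    rw [harg, abs_of_pos Real.pi_pos] at this
    linarith [Real.pi_pos]

end IsLaplace

/-! ### Positivity and bounds for the Lévy density -/

lemma measurable_kernelOne (m : ℕ) : Measurable (kernelOne m) := by
  unfold kernelOne
  fun_prop

lemma kernelOne_pos (m : ℕ) {t : ℝ} (ht : 0 < t) : 0 < kernelOne m t :=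
  pow_pos (inv_pos.mpr (one_sub_exp_neg_pos ht)) m

lemma kernelOne_le (m : ℕ) {t : ℝ} (ht : 0 < t) : kernelOne m t ≤ ((1 + t) / t) ^ m := by
  refine pow_le_pow_left₀ (inv_pos.mpr (one_sub_exp_neg_pos ht)).le ?_ m
  rw [← inv_div]
  refine inv_anti₀ (by positivity) ?_
  have h : Real.exp (-t) ≤ (1 + t)⁻¹ := by
    rw [Real.exp_neg]
    exact inv_anti₀ (by positivity) (by linarith [Real.add_one_le_exp t])
  have : t / (1 + t) = 1 - (1 + t)⁻¹ := by field_simp; ring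
  linarith

lemma le_kernelOne (m : ℕ) {t : ℝ} (ht : 0 < t) : (t⁻¹) ^ m ≤ kernelOne m t := by
  refine pow_le_pow_left₀ (inv_pos.mpr ht).le ?_ m
  exact inv_anti₀ (one_sub_exp_neg_pos ht) (by linarith [Real.one_sub_le_exp_neg t])

section

variable {N : ℕ} (b : Fin (N + 1) → ℝ) (M : ℕ)

/-- The function `∏_{j=1}^N (1 - e^{-b_j t}) (1 - e^{-t})^{-M}`. -/
def ratioKernel (t : ℝ) : ℝ := (∏ j : Fin N, (1 - Real.exp (-(b j.succ * t)))) * kernelOne M t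

/-- The value of `ratioKernel` at `0+`. -/
def ratioKernelZero : ℝ := if N = M then ∏ j : Fin N, b j.succ else 0

/-- The Lévy density that remains after the removal of a Gamma component. -/
def levyRem (t : ℝ) : ℝ :=
  (Real.exp (-(b 0 * t)) * ratioKernel b M t -
    ratioKernelZero b M * Real.exp (-((b 0 + ∑ j : Fin N, b j.succ) * t))) / t

lemma measurable_levyRem : Measurable (levyRem b M) := by
  have := measurable_kernelOne M
  unfold levyRem ratioKernel
  fun_prop

lemma ratioKernelZero_nonneg (hb : ∀ k, 0 < b k) : 0 ≤ ratioKernelZero b M := by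
  unfold ratioKernelZero
  split_ifs
  · exact prod_nonneg fun _ _ => (hb _).le
  · exact le_rfl

variable (hb : ∀ k, 0 < b k) {t : ℝ} (ht : 0 < t)
include hb ht

lemma ratioKernel_nonneg : 0 ≤ ratioKernel b M t :=
  mul_nonneg (prod_nonneg fun _ _ => (one_sub_exp_neg_pos (mul_pos (hb _) ht)).le)
    (kernelOne_pos M ht).le

lemma ratioKernel_le (hMN : M ≤ N) :
    ratioKernel b M t ≤ (∏ j : Fin N, b j.succ) * t ^ (N - M) * (1 + t) ^ M := by
  have h1 : ∏ j : Fin N, (1 - Real.exp (-(b j.succ * t))) ≤ ∏ j : Fin N, (b j.succ * t) :=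
    prod_le_prod (fun _ _ => (one_sub_exp_neg_pos (mul_pos (hb _) ht)).le)
      fun j _ => by linarith [Real.one_sub_le_exp_neg (b j.succ * t)]
  rw [prod_mul_distrib, prod_const, card_univ, Fintype.card_fin] at h1
  have hp : 0 ≤ ∏ j : Fin N, b j.succ := prod_nonneg fun _ _ => (hb _).le
  calc ratioKernel b M t
      ≤ ((∏ j : Fin N, b j.succ) * t ^ N) * ((1 + t) / t) ^ M :=
        mul_le_mul h1 (kernelOne_le M ht) (kernelOne_pos M ht).le (by positivity)
    _ = (∏ j : Fin N, b j.succ) * t ^ (N - M) * (1 + t) ^ M := by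
        have h2 : t ^ N = t ^ (N - M) * t ^ M := by rw [← pow_add, Nat.sub_add_cancel hMN]
        rw [div_pow, h2]
        field_simp

lemma ratioKernel_le' (hMN : M ≤ N) :
    ratioKernel b M t ≤ (∏ j : Fin N, b j.succ) * (1 + t) ^ N := by
  have hp : 0 ≤ ∏ j : Fin N, b j.succ := prod_nonneg fun _ _ => (hb _).le
  refine (ratioKernel_le b M hb ht hMN).trans ?_
  rw [mul_assoc]
  refine mul_le_mul_of_nonneg_left ?_ hp
  calc t ^ (N - M) * (1 + t) ^ M ≤ (1 + t) ^ (N - M) * (1 + t) ^ M := by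
        gcongr; linarith
    _ = (1 + t) ^ N := by rw [← pow_add, Nat.sub_add_cancel hMN]

/-- For `N = M`, multiply the factorwise bounds `1 - e^{-x} ≥ x e^{-x}` and `(1 - e^{-t})^{-1} ≥
1/t`; the powers of `t` cancel. The product of the exponentials dictates the rate `b_0 + ∑ b_j` of
the Gamma part, which keeps the remainder nonnegative. -/
lemma ratioKernelZero_mul_le :
    ratioKernelZero b M * Real.exp (-((∑ j : Fin N, b j.succ) * t)) ≤ ratioKernel b M t := by
  unfold ratioKernelZero
  split_ifs with h
  · subst h
    have h1 : ∏ j : Fin N, (b j.succ * t * Real.exp (-(b j.succ * t))) ≤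
        ∏ j : Fin N, (1 - Real.exp (-(b j.succ * t))) := by
      refine prod_le_prod (fun j _ => ?_) fun j _ => ?_
      · have := hb j.succ
        positivity
      · have h2 := Real.add_one_le_exp (b j.succ * t)
        have h3 : Real.exp (b j.succ * t) * Real.exp (-(b j.succ * t)) = 1 := by
          rw [← Real.exp_add]; simp
        nlinarith [Real.exp_pos (-(b j.succ * t))]
    have h4 : (∏ j : Fin N, b j.succ) * Real.exp (-((∑ j : Fin N, b j.succ) * t)) =
        (∏ j : Fin N, (b j.succ * t * Real.exp (-(b j.succ * t)))) * (t⁻¹) ^ N := by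
      rw [prod_mul_distrib, prod_mul_distrib, prod_const, card_univ, Fintype.card_fin,
        ← Real.exp_sum, sum_neg_distrib, sum_mul, mul_right_comm, mul_assoc (∏ j : Fin N, b j.succ),
        ← mul_pow, mul_inv_cancel₀ ht.ne', one_pow, mul_one]
    rw [h4]
    exact mul_le_mul h1 (le_kernelOne N ht) (by positivity)
      (prod_nonneg fun j _ => (one_sub_exp_neg_pos (mul_pos (hb _) ht)).le)
  · rw [zero_mul]
    exact ratioKernel_nonneg b M hb ht

omit hb ht in
lemma exp_neg_add_mul_split :
    Real.exp (-((b 0 + ∑ j : Fin N, b j.succ) * t)) =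
      Real.exp (-(b 0 * t)) * Real.exp (-((∑ j : Fin N, b j.succ) * t)) := by
  rw [← Real.exp_add]
  ring_nf

lemma levyRem_nonneg : 0 ≤ levyRem b M t := by
  refine div_nonneg ?_ ht.le
  rw [exp_neg_add_mul_split b, mul_left_comm, ← mul_sub]
  exact mul_nonneg (Real.exp_nonneg _) (sub_nonneg.mpr (ratioKernelZero_mul_le b M hb ht))

omit hb in
lemma one_add_pow_sub_one_le (n : ℕ) : (1 + t) ^ n - 1 ≤ n * t * (1 + t) ^ n := by
  induction n with
  | zero => simp
  | succ n ih =>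
    have h1 : (1 + t) ^ n ≤ (1 + t) ^ (n + 1) := pow_le_pow_right₀ (by linarith) (by omega)
    have h2 : (n : ℝ) * t * (1 + t) ^ n ≤ n * t * (1 + t) ^ (n + 1) := by gcongr
    have h3 : t * (1 + t) ^ n ≤ t * (1 + t) ^ (n + 1) := by gcongr
    push_cast
    have h4 : (1 + t) ^ (n + 1) = (1 + t) ^ n + t * (1 + t) ^ n := by ring
    linarith

/-- The numerator must supply a factor `t` against the division by `t`. If `M < N`, it is a spare
power of `t` in `ratioKernel`; if `M = N`, it comes from the cancellation of the values at `0+`. -/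
lemma levyRem_le (hMN : M ≤ N) :
    levyRem b M t ≤ (∏ j : Fin N, b j.succ) * (1 + N + ∑ j : Fin N, b j.succ) *
      ((1 + t) ^ N * Real.exp (-(b 0 * t))) := by
  have hp : 0 ≤ ∏ j : Fin N, b j.succ := prod_nonneg fun _ _ => (hb _).le
  have hB : 0 ≤ ∑ j : Fin N, b j.succ := sum_nonneg fun j _ => (hb _).le
  set P := ∏ j : Fin N, b j.succ with hP
  set B := ∑ j : Fin N, b j.succ with hBdef
  have h1t : 1 ≤ (1 + t) ^ N := one_le_pow₀ (by linarith)
  have key : ratioKernel b M t - ratioKernelZero b M * Real.exp (-(B * t)) ≤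
      P * (1 + N + B) * (1 + t) ^ N * t := by
    rcases hMN.eq_or_lt with h | h
    · have h1 := ratioKernel_le' b M hb ht hMN
      have h2 := one_add_pow_sub_one_le ht N
      have h3 := Real.one_sub_le_exp_neg (B * t)
      have h4 : B * t ≤ B * t * (1 + t) ^ N := le_mul_of_one_le_right (by positivity) h1t
      rw [ratioKernelZero, if_pos h.symm, ← hP]
      have h5 : (1 + t) ^ N - Real.exp (-(B * t)) ≤ (1 + N + B) * (1 + t) ^ N * t := by
        have : 0 ≤ (1 + t) ^ N * t := by positivity
        linarith
      have h6 := mul_le_mul_of_nonneg_left h5 hp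
      linarith
    · have h1 := ratioKernel_le b M hb ht hMN
      rw [ratioKernelZero, if_neg h.ne', zero_mul, sub_zero]
      refine h1.trans ?_
      have h2 : t ^ (N - M) * (1 + t) ^ M ≤ (1 + t) ^ N * t := by
        obtain ⟨d, hd⟩ : ∃ d, N - M = d + 1 := ⟨N - M - 1, by omega⟩
        have h3 : N = (d + 1) + M := by omega
        rw [hd]
        calc t ^ (d + 1) * (1 + t) ^ M = t ^ d * (1 + t) ^ M * t := by ring
          _ ≤ (1 + t) ^ (d + 1) * (1 + t) ^ M * t := by
            gcongr ?_ * _ * _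
            exact (pow_le_pow_left₀ ht.le (by linarith) d).trans
              (pow_le_pow_right₀ (by linarith) (by omega))
          _ = (1 + t) ^ N * t := by rw [h3, pow_add _ (d + 1)]
      have h4 : (1 + t) ^ N * t ≤ (1 + N + B) * ((1 + t) ^ N * t) :=
        le_mul_of_one_le_left (by positivity) (by
          have : (0 : ℝ) ≤ N := by positivity
          linarith)
      have h5 := mul_le_mul_of_nonneg_left (h2.trans h4) hp
      linarith
  rw [levyRem, div_le_iff₀ ht, exp_neg_add_mul_split b, mul_left_comm, ← mul_sub]
  have := mul_le_mul_of_nonneg_left key (Real.exp_nonneg (-(b 0 * t)))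
  linarith

end

lemma one_add_pow_le_exp (N : ℕ) {a : ℝ} (ha : 0 < a) :
    ∃ C : ℝ, ∀ t > 0, (1 + t) ^ N ≤ C * Real.exp (a * t) := by
  refine ⟨N.factorial / a ^ N * Real.exp a, fun t ht => ?_⟩
  have h := Real.pow_div_factorial_le_exp (x := a * (1 + t)) (by positivity) N
  rw [div_le_iff₀ (by positivity), mul_pow, mul_add, mul_one, Real.exp_add] at h
  have ha' : 0 < a ^ N := by positivity
  rw [div_mul_eq_mul_div, div_mul_eq_mul_div, le_div_iff₀ ha']
  linarith

lemma levyRem_integrableOn {N : ℕ} (b : Fin (N + 1) → ℝ) (hb : ∀ k, 0 < b k) {M : ℕ}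
    (hMN : M ≤ N) {q : ℂ} (hq : -b 0 < q.re) :
    IntegrableOn (fun t : ℝ => levyRem b M t * Complex.exp (-(q * t))) (Set.Ioi 0) := by
  -- Half of the available decay rate is spent on absorbing the factor `(1 + t)^N`.
  have ha : 0 < (b 0 + q.re) / 2 := by linarith
  obtain ⟨C, hC⟩ := one_add_pow_le_exp N ha
  have hP : 0 ≤ (∏ j : Fin N, b j.succ) * (1 + N + ∑ j : Fin N, b j.succ) := by
    have := fun k => (hb k).le
    refine mul_nonneg (prod_nonneg fun j _ => this _) ?_
    have := sum_nonneg (s := univ) fun (j : Fin N) _ => this j.succ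
    positivity
  refine Integrable.mono'
    (g := fun t => (∏ j : Fin N, b j.succ) * (1 + N + ∑ j : Fin N, b j.succ) * C *
      Real.exp (-((b 0 + q.re) / 2) * t)) ?_ ?_ ?_
  · exact (exp_neg_integrableOn_Ioi 0 ha).const_mul _
  · have := measurable_levyRem b M
    exact Measurable.aestronglyMeasurable (by fun_prop)
  · filter_upwards [ae_restrict_mem measurableSet_Ioi] with t ht
    rw [norm_mul, Complex.norm_real, Real.norm_of_nonneg (levyRem_nonneg b M hb ht),
      Complex.norm_exp]
    have h1 := levyRem_le b M hb ht hMN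
    have h2 := mul_le_mul_of_nonneg_right (hC t ht) (Real.exp_nonneg (-(b 0 * t)))
    have h3 := h1.trans (mul_le_mul_of_nonneg_left h2 hP)
    refine (mul_le_mul_of_nonneg_right h3 (Real.exp_nonneg _)).trans (le_of_eq ?_)
    rw [show -((b 0 + q.re) / 2) * t = (b 0 + q.re) / 2 * t + -(b 0 * t) + (-(q * (t : ℂ))).re by
      simp; ring, Real.exp_add, Real.exp_add]
    ring

/-! ### The operator `S_N` and the Laplace exponent of the Barnes beta law -/

section

variable {N : ℕ} (b : Fin (N + 1) → ℝ)

lemma opS_eq_sum_powerset (f : ℂ → ℂ) (q : ℂ) :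
    opS b f q = ∑ K : Finset (Fin N), (-1 : ℂ) ^ K.card *
      f (q + (b 0 : ℂ) + ∑ k ∈ K, (b k.succ : ℂ)) := by
  rw [opS, ← powerset_univ, sum_powerset, card_univ, Fintype.card_fin]
  refine sum_congr rfl fun p _ => ?_
  rw [mul_sum]
  exact sum_congr rfl fun K hK => by rw [(mem_powersetCard.mp hK).2]

lemma sum_exp_neg_eq_prod (t : ℝ) :
    ∑ K : Finset (Fin N), (-1 : ℂ) ^ K.card * Complex.exp (-((∑ k ∈ K, (b k.succ : ℂ)) * t)) =
      ((∏ j : Fin N, (1 - Real.exp (-(b j.succ * t))) : ℝ) : ℂ) := by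
  simp_rw [sub_eq_add_neg]
  rw [prod_one_add, powerset_univ]
  push_cast
  refine sum_congr rfl fun K _ => ?_
  rw [prod_neg, sum_mul, ← sum_neg_distrib, Complex.exp_sum]

lemma exp_neg_mul_sub_one_isBigO (q : ℂ) :
    (fun t : ℝ => Complex.exp (-(q * t)) - 1) =O[𝓝[>] 0] (fun t : ℝ => t) := by
  have h : HasDerivAt (fun t : ℝ => Complex.exp (-(q * t))) (-q) 0 := by
    have h1 : HasDerivAt (fun t : ℝ => -(q * (t : ℂ))) (-q) 0 := by
      simpa using ((Complex.ofRealCLM.hasDerivAt (x := (0 : ℝ))).const_mul q).fun_neg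
    simpa using h1.cexp
  have := h.isBigO_sub.mono (nhdsWithin_le_nhds (s := Set.Ioi (0 : ℝ)))
  simpa using this

variable (hb : ∀ k, 0 < b k) {M : ℕ} (hMN : M ≤ N)
include hb hMN

lemma opS_logGamma_sub {q : ℂ} (hq : -b 0 < q.re) :
    IntegrableOn (fun t : ℝ => (Complex.exp (-(q * t)) - 1) *
        ((Real.exp (-(b 0 * t)) * ratioKernel b M t : ℝ) : ℂ) / t) (Set.Ioi 0) ∧
      opS b (logGamma (fun _ : Fin M => (1 : ℝ))) q -
        opS b (logGamma (fun _ : Fin M => (1 : ℝ))) 0 =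
      ∫ t in Set.Ioi (0 : ℝ), (Complex.exp (-(q * t)) - 1) *
        ((Real.exp (-(b 0 * t)) * ratioKernel b M t : ℝ) : ℂ) / t := by
  -- The Boolean separates the terms at `q` from those at `0`. Their difference yields the factor
  -- `e^{-qt} - 1 = O(t)`, while `M ≤ N` keeps the rest bounded near `0`.
  let α : Finset (Fin N) × Bool → ℂ := fun p => (-1) ^ p.1.card * (if p.2 then 1 else -1)
  let w : Finset (Fin N) × Bool → ℂ := fun p =>
    (if p.2 then q else 0) + (b 0 : ℂ) + ∑ k ∈ p.1, (b k.succ : ℂ)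
  have hexp : expSum univ α w M = fun t : ℝ => (Complex.exp (-(q * t)) - 1) *
      ((Real.exp (-(b 0 * t)) * ratioKernel b M t : ℝ) : ℂ) := by
    funext t
    rw [ratioKernel, Complex.ofReal_mul, Complex.ofReal_mul, ← sum_exp_neg_eq_prod b t, expSum,
      Fintype.sum_prod_type, sum_mul, mul_sum, mul_sum]
    refine sum_congr rfl fun K _ => ?_
    simp only [Fintype.sum_bool, α, w, if_true, Bool.false_eq_true, if_false, add_mul,
      zero_mul, neg_add, neg_zero, Complex.exp_add, Complex.exp_zero]
    push_cast
    ring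
  have hδ : 0 < min (q.re + b 0) (b 0) := lt_min (by linarith) (hb 0)
  have hw : ∀ p ∈ univ, min (q.re + b 0) (b 0) ≤ (w p).re := by
    rintro ⟨K, c⟩ -
    have h1 : 0 ≤ ∑ k ∈ K, b k.succ := sum_nonneg fun k _ => (hb _).le
    have h2 : (w (K, c)).re = (if c then q.re else 0) + b 0 + ∑ k ∈ K, b k.succ := by
      cases c <;> simp [w]
    rw [h2]
    cases c
    · exact (min_le_right _ _).trans (by simpa using h1)
    · exact (min_le_left _ _).trans (by simpa using h1)
  have hO : expSum univ α w M =O[𝓝[>] 0] (fun t : ℝ => t) := by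
    rw [hexp]
    have h1 : (fun t : ℝ => ((Real.exp (-(b 0 * t)) * ratioKernel b M t : ℝ) : ℂ))
        =O[𝓝[>] 0] (fun _ : ℝ => (1 : ℝ)) := by
      refine Complex.isBigO_ofReal_left.mpr ?_
      refine (IsBigO.of_bound 1 ?_).trans
        (g := fun t : ℝ => (∏ j : Fin N, b j.succ) * (1 + t) ^ N) ?_
      · filter_upwards [self_mem_nhdsWithin] with t ht
        have ht : 0 < t := ht
        have h0 := ratioKernel_nonneg b M hb ht
        have h2 := ratioKernel_le' b M hb ht hMN
        rw [one_mul, Real.norm_of_nonneg (mul_nonneg (Real.exp_nonneg _) h0),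
          Real.norm_of_nonneg (h0.trans h2)]
        refine (mul_le_of_le_one_left h0 ?_).trans h2
        exact Real.exp_le_one_iff.mpr (neg_nonpos.mpr (mul_pos (hb 0) ht).le)
      · have : Continuous fun t : ℝ => (∏ j : Fin N, b j.succ) * (1 + t) ^ N := by fun_prop
        exact ((this.tendsto 0).mono_left nhdsWithin_le_nhds).isBigO_one ℝ
    simpa using (exp_neg_mul_sub_one_isBigO q).mul h1
  have h := sum_logGamma_eq_integral univ α w M hδ hw hO
  rw [hexp] at h
  refine ⟨h.1, h.2 ▸ ?_⟩
  rw [opS_eq_sum_powerset, opS_eq_sum_powerset, ← sum_sub_distrib, Fintype.sum_prod_type]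
  refine sum_congr rfl fun K _ => ?_
  simp only [Fintype.sum_bool, α, w, if_true, Bool.false_eq_true, if_false]
  ring

omit b hb hMN in
/-- Frullani's integral. -/
lemma log_sub_log_add_eq_integral {r : ℝ} (hr : 0 < r) {q : ℂ} (hq : -r < q.re) :
    IntegrableOn (fun t : ℝ => (Complex.exp (-(q * t)) - 1) * Complex.exp (-(r * t)) / t)
        (Set.Ioi 0) ∧
      Complex.log r - Complex.log (r + q) = ∫ t in Set.Ioi (0 : ℝ),
        (Complex.exp (-(q * t)) - 1) * Complex.exp (-(r * t)) / t := by
  -- Frullani's integral is the two-term case of `sum_logGamma_eq_integral` with `m = 0`, because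
  -- `L_0 = -log`.
  let α : Bool → ℂ := fun c => if c then 1 else -1
  let w : Bool → ℂ := fun c => if c then r + q else r
  have hexp : expSum univ α w 0 = fun t : ℝ =>
      (Complex.exp (-(q * t)) - 1) * Complex.exp (-(r * t)) := by
    funext t
    simp only [expSum, Fintype.sum_bool, α, w, if_true, Bool.false_eq_true, if_false, add_mul,
      neg_add, Complex.exp_add, kernelOne, pow_zero, Complex.ofReal_one]
    ring
  have hrq : 0 < (r + q).re := by simp; linarith
  have hw : ∀ c ∈ univ, min r (r + q).re ≤ (w c).re := by
    rintro c -
    cases c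
    · exact min_le_left _ _
    · exact min_le_right _ _
  have hO : expSum univ α w 0 =O[𝓝[>] 0] (fun t : ℝ => t) := by
    rw [hexp]
    have h1 : (fun t : ℝ => Complex.exp (-(r * t))) =O[𝓝[>] 0] (fun _ : ℝ => (1 : ℝ)) := by
      have : Continuous fun t : ℝ => Complex.exp (-(r * t)) := by fun_prop
      exact ((this.tendsto 0).mono_left nhdsWithin_le_nhds).isBigO_one ℝ
    simpa using (exp_neg_mul_sub_one_isBigO q).mul h1
  have h := sum_logGamma_eq_integral univ α w 0 (lt_min hr hrq) hw hO
  rw [hexp] at h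
  refine ⟨h.1, h.2 ▸ ?_⟩
  simp only [Fintype.sum_bool, α, w, if_true, Bool.false_eq_true, if_false]
  rw [logGamma_zero hrq, logGamma_zero (by simpa using hr)]
  ring

/-- The singular part of the Lévy density is integrated by Frullani and becomes a Gamma exponent;
the integrable rest is split into two convergent integrals, a compound Poisson exponent. -/
lemma opS_logGamma_sub_eq {q : ℂ} (hq : -b 0 < q.re) :
    opS b (logGamma (fun _ : Fin M => (1 : ℝ))) q -
        opS b (logGamma (fun _ : Fin M => (1 : ℝ))) 0 =
      ratioKernelZero b M * (Complex.log ((b 0 + ∑ j : Fin N, b j.succ : ℝ) : ℂ) -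
        Complex.log (((b 0 + ∑ j : Fin N, b j.succ : ℝ) : ℂ) + q)) +
      ((∫ t in Set.Ioi (0 : ℝ), levyRem b M t * Complex.exp (-(q * t))) -
        ∫ t in Set.Ioi (0 : ℝ), levyRem b M t * Complex.exp (-(0 * t))) := by
  have hB : 0 ≤ ∑ j : Fin N, b j.succ := sum_nonneg fun j _ => (hb _).le
  have hr : 0 < b 0 + ∑ j : Fin N, b j.succ := by linarith [hb 0]
  obtain ⟨h1, h2⟩ := opS_logGamma_sub b hb hMN hq
  obtain ⟨h3, h4⟩ := log_sub_log_add_eq_integral hr (q := q) (by linarith)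
  have h5 := levyRem_integrableOn b hb hMN hq
  have h6 := levyRem_integrableOn b hb hMN (q := 0) (by simpa using hb 0)
  have h7 := integral_add (h3.const_mul (ratioKernelZero b M : ℂ)) (h5.sub h6)
  simp only [Pi.sub_apply] at h7
  rw [h2, h4, ← integral_const_mul, ← integral_sub h5 h6, ← h7]
  refine setIntegral_congr_fun measurableSet_Ioi fun t ht => ?_
  have ht0 : (t : ℂ) ≠ 0 := by exact_mod_cast (ne_of_gt ht)
  simp only [levyRem, zero_mul, neg_zero, Complex.exp_zero]
  push_cast
  field_simp
  ring

theorem exists_isLaplace_eta :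
    ∃ ρ : Measure ℝ, IsLaplace ρ (-b 0) (eta (fun _ : Fin M => (1 : ℝ)) b) := by
  have hB : 0 ≤ ∑ j : Fin N, b j.succ := sum_nonneg fun j _ => (hb _).le
  have hx : -b 0 < 0 := neg_lt_zero.mpr (hb 0)
  obtain ⟨ρ₁, h₁⟩ := IsLaplace.exists_gamma (x := -b 0) (ratioKernelZero_nonneg b M hb)
    (r := b 0 + ∑ j : Fin N, b j.succ) (by linarith) (by linarith)
  obtain ⟨ρ₂, h₂⟩ := IsLaplace.of_density (x := -b 0) (measurable_levyRem b M)
    (fun t ht => levyRem_nonneg b M hb ht) fun q hq => levyRem_integrableOn b hb hMN hq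
  obtain ⟨ρ₃, h₃⟩ := h₂.exists_exp hx
  refine ⟨_, (h₁.conv hx h₃).congr fun q hq => ?_⟩
  rw [Pi.mul_apply, ← Complex.exp_add, eta, opS_logGamma_sub_eq b hb hMN hq]

end

/-! ### Existence, uniqueness and finiteness of the moments -/

lemma cpow_exp_neg (x : ℝ) (q : ℂ) : ((Real.exp (-x) : ℝ) : ℂ) ^ q = Complex.exp (-(q * x)) := by
  rw [Complex.cpow_def_of_ne_zero (by exact_mod_cast (Real.exp_pos _).ne'),
    ← Complex.ofReal_log (Real.exp_pos _).le, Real.log_exp]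
  congr 1
  push_cast
  ring

theorem exists_isBarnesBeta {M N : ℕ} (hMN : M ≤ N) (b : Fin (N + 1) → ℝ) (hb : ∀ k, 0 < b k) :
    ∃ μ : Measure ℝ, IsBarnesBeta (fun _ : Fin M => (1 : ℝ)) b μ := by
  obtain ⟨ρ, hρ⟩ := exists_isLaplace_eta b hb hMN
  have hx : -b 0 < 0 := neg_lt_zero.mpr (hb 0)
  have hp := hρ.isProbabilityMeasure hx (by simp [eta])
  have hm : AEMeasurable (fun x : ℝ => Real.exp (-x)) ρ := by fun_prop
  have hf (q : ℂ) : AEStronglyMeasurable (fun x : ℝ => (x : ℂ) ^ q)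
      (ρ.map fun x : ℝ => Real.exp (-x)) :=
    (Complex.measurable_ofReal.pow_const q).aestronglyMeasurable
  refine ⟨ρ.map fun x : ℝ => Real.exp (-x), Measure.isProbabilityMeasure_map hm, ?_, fun q hq => ?_,
    fun q hq => ?_⟩
  · change ∀ᵐ x ∂(ρ.map fun x : ℝ => Real.exp (-x)), x ∈ Set.Ioc (0 : ℝ) 1
    rw [ae_map_iff (p := fun x => x ∈ Set.Ioc (0 : ℝ) 1) hm measurableSet_Ioc]
    filter_upwards [hρ.nonneg] with x hx
    exact ⟨Real.exp_pos _, Real.exp_le_one_iff.mpr (neg_nonpos.mpr hx)⟩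
  · rw [integrable_map_measure (hf q) hm]
    exact (hρ.integrable q hq).congr (Eventually.of_forall fun x => (cpow_exp_neg x q).symm)
  · rw [integral_map hm (hf q), ← hρ.integral_eq q hq]
    exact integral_congr_ae (Eventually.of_forall fun x => cpow_exp_neg x q)

namespace IsBarnesBeta

variable {M N : ℕ} {a : Fin M → ℝ} {b : Fin (N + 1) → ℝ} {μ : Measure ℝ}

lemma ae_mem (h : IsBarnesBeta a b μ) : ∀ᵐ x ∂μ, x ∈ Set.Ioc (0 : ℝ) 1 := h.supported

lemma map_exp_map_log (h : IsBarnesBeta a b μ) : (μ.map Real.log).map Real.exp = μ := by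
  rw [Measure.map_map Real.measurable_exp Real.measurable_log]
  conv_rhs => rw [← Measure.map_id (μ := μ)]
  refine Measure.map_congr ?_
  filter_upwards [h.ae_mem] with x hx using Real.exp_log hx.1

lemma charFun_map_log (h : IsBarnesBeta a b μ) (hb : 0 < b 0) (θ : ℝ) :
    charFun (μ.map Real.log) θ = eta a b (θ * Complex.I) := by
  rw [← h.mellin _ (by simpa using hb), charFun_apply_real,
    integral_map Real.measurable_log.aemeasurable
      (Continuous.aestronglyMeasurable (by fun_prop))]
  refine integral_congr_ae ?_
  filter_upwards [h.ae_mem] with x hx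
  rw [Complex.cpow_def_of_ne_zero (by exact_mod_cast hx.1.ne'), Complex.ofReal_log hx.1.le]
  congr 1
  ring

/-- Since `b_0 > 0`, the imaginary axis lies in the half-plane where the Mellin transform is
prescribed, and there it is the characteristic function of `log`; `exp` recovers the measure. -/
theorem unique {μ' : Measure ℝ} (hb : 0 < b 0) (h : IsBarnesBeta a b μ)
    (h' : IsBarnesBeta a b μ') : μ = μ' := by
  have := h.isProbabilityMeasure
  have := h'.isProbabilityMeasure
  rw [← h.map_exp_map_log, ← h'.map_exp_map_log]
  have : μ.map Real.log = μ'.map Real.log := by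
    refine Measure.ext_of_charFun (funext fun θ => ?_)
    rw [h.charFun_map_log hb, h'.charFun_map_log hb]
  rw [this]

lemma moment (h : IsBarnesBeta a b μ) (hb : 0 < b 0) (n : ℕ) :
    Integrable (fun x : ℝ => x ^ n) μ ∧ ((∫ x : ℝ, x ^ n ∂μ : ℝ) : ℂ) = eta a b n := by
  have hn : -b 0 < ((n : ℂ)).re := by
    rw [Complex.natCast_re]
    have : (0 : ℝ) ≤ n := by positivity
    linarith
  have he : (fun x : ℝ => (x : ℂ) ^ (n : ℂ)) = fun x : ℝ => ((x ^ n : ℝ) : ℂ) := by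
    funext x
    simp
  have h1 := h.integrable n hn
  have h2 := h.mellin n hn
  rw [he] at h1 h2
  exact ⟨h1.re, by rw [← h2, integral_complex_ofReal]⟩

end IsBarnesBeta

/-! ### Difference equations and the moment formula -/

lemma opS_logGamma_succ_add_one {N : ℕ} (b : Fin (N + 1) → ℝ) (hb : ∀ k, 0 < b k) (m n : ℕ) :
    opS b (logGamma (fun _ : Fin (m + 1) => (1 : ℝ))) (n + 1 : ℕ) =
      opS b (logGamma (fun _ : Fin (m + 1) => (1 : ℝ))) n -
        opS b (logGamma (fun _ : Fin m => (1 : ℝ))) n := by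
  simp_rw [opS_eq_sum_powerset]
  rw [← sum_sub_distrib]
  refine sum_congr rfl fun K _ => ?_
  rw [← mul_sub, ← logGamma_add_one]
  · congr 2
    push_cast
    ring
  · have h1 : 0 ≤ ∑ k ∈ K, b k.succ := sum_nonneg fun k _ => (hb _).le
    have h2 : (0 : ℝ) ≤ n := by positivity
    have := hb 0
    simp
    linarith

/-- The additive analogue of `nestedProd`. -/
def nestedSum (g : ℕ → ℂ) : ℕ → ℕ → ℂ
  | 0, n => g n
  | M + 1, n => ∑ i ∈ range n, nestedSum g M i

lemma exp_mul_nestedSum (c : ℂ) (g : ℕ → ℂ) (M n : ℕ) :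
    Complex.exp (c * nestedSum g M n) = nestedProd (fun m => Complex.exp (c * g m)) M n := by
  induction M generalizing n with
  | zero => rfl
  | succ M ih => rw [nestedSum, nestedProd, mul_sum, Complex.exp_sum]; simp_rw [ih]

/-- Iterated summation of a system of first-order difference equations. -/
lemma eq_nestedSum_of_difference (A : ℕ → ℕ → ℂ)
    (hA : ∀ m n, A (m + 1) (n + 1) = A (m + 1) n - A m n) (M n : ℕ) :
    A M n = ∑ i ∈ range M, (-1 : ℂ) ^ i * (n.choose i : ℂ) * A (M - i) 0 +
      (-1 : ℂ) ^ M * nestedSum (A 0) M n := by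
  induction M generalizing n with
  | zero => simp [nestedSum]
  | succ M ih =>
    have h1 : A (M + 1) n = A (M + 1) 0 - ∑ j ∈ range n, A M j := by
      induction n with
      | zero => simp
      | succ n ihn => rw [hA, ihn, sum_range_succ]; ring
    -- The hockey-stick identity: each further summation raises the lower index of the binomial
    -- coefficients.
    have h2 (i : ℕ) : ∑ j ∈ range n, (j.choose i : ℂ) = (n.choose (i + 1) : ℂ) := by
      clear h1
      induction n with
      | zero => simp
      | succ n ihn => rw [sum_range_succ, ihn, Nat.choose_succ_succ']; push_cast; ring
    rw [h1, sum_congr rfl fun j _ => ih j, sum_add_distrib, sum_comm, sum_range_succ', nestedSum,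
      ← mul_sum]
    simp_rw [← sum_mul, ← mul_sum, h2, Nat.add_sub_add_right, pow_succ]
    simp only [mul_neg, mul_one, neg_mul, sum_neg_distrib, pow_zero, Nat.choose_zero_right,
      Nat.cast_one, one_mul, Nat.sub_zero]
    ring

lemma exp_sub_eq_nestedProd_of_difference (A : ℕ → ℕ → ℂ)
    (hA : ∀ m n, A (m + 1) (n + 1) = A (m + 1) n - A m n) {M : ℕ} (hM : 1 ≤ M) (n : ℕ) :
    Complex.exp (A M n - A M 0) =
      (∏ i ∈ Icc 1 (M - 1), Complex.exp ((-1 : ℂ) ^ i * (n.choose i : ℂ) * A (M - i) 0)) *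
      nestedProd (fun m : ℕ => Complex.exp ((-1 : ℂ) ^ M * A 0 m)) M n := by
  obtain ⟨m, rfl⟩ : ∃ m, M = m + 1 := ⟨M - 1, by omega⟩
  have hI : Icc 1 (m + 1 - 1) = (range m).map (addRightEmbedding 1) := by
    rw [Nat.add_sub_cancel, range_eq_Ico, map_add_right_Ico]
    rfl
  -- The term `i = 0` of the sum is `A M 0` itself and cancels, so the product starts at `i = 1`.
  rw [eq_nestedSum_of_difference A hA (m + 1) n, ← exp_mul_nestedSum, ← Complex.exp_sum,
    ← Complex.exp_add, sum_range_succ', hI, sum_map]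
  congr 1
  simp only [addRightEmbedding_apply, pow_zero, Nat.choose_zero_right, Nat.cast_one, one_mul,
    Nat.sub_zero]
  ring

theorem eta_natCast {M N : ℕ} (hM : 1 ≤ M) (b : Fin (N + 1) → ℝ) (hb : ∀ k, 0 < b k) (n : ℕ) :
    eta (fun _ : Fin M => (1 : ℝ)) b n =
      (∏ i ∈ Icc 1 (M - 1), Complex.exp ((-1 : ℂ) ^ i * (n.choose i : ℂ) *
        opS b (logGamma (fun _ : Fin (M - i) => (1 : ℝ))) 0)) *
      nestedProd (fun m : ℕ => Complex.exp ((-1 : ℂ) ^ M *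
        opS b (logGamma (fun _ : Fin 0 => (1 : ℝ))) (m : ℂ))) M n := by
  rw [eta]
  simpa only [Nat.cast_zero] using exp_sub_eq_nestedProd_of_difference
    (fun m n => opS b (logGamma (fun _ : Fin m => (1 : ℝ))) (n : ℂ))
    (opS_logGamma_succ_add_one b hb) hM n

/-- All arguments are positive reals, so the complex logarithms are real. The minus sign in `L_0 =
-log` puts even `p` in the denominator and odd `p` in the numerator. -/
lemma exp_neg_one_pow_mul_opS {N : ℕ} (b : Fin (N + 1) → ℝ) (hb : ∀ k, 0 < b k) (M m : ℕ) :
    Complex.exp ((-1 : ℂ) ^ M * opS b (logGamma (fun _ : Fin 0 => (1 : ℝ))) (m : ℂ)) =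
      ((altProd b (m : ℝ) ^ ((-1 : ℤ) ^ M) : ℝ) : ℂ) := by
  have hpos (K : Finset (Fin N)) : 0 < (m : ℝ) + b 0 + ∑ j ∈ K, b j.succ := by
    have h1 : 0 ≤ ∑ k ∈ K, b k.succ := sum_nonneg fun k _ => (hb _).le
    have h2 : (0 : ℝ) ≤ m := by positivity
    linarith [hb 0]
  have hlin (p : ℕ) : 0 < linProd b p m := prod_pos fun K _ => hpos K
  have hL : opS b (logGamma (fun _ : Fin 0 => (1 : ℝ))) (m : ℂ) =
      ((∑ p ∈ range (N + 1), (-1 : ℝ) ^ p * -Real.log (linProd b p m) : ℝ) : ℂ) := by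
    rw [opS]
    push_cast
    refine sum_congr rfl fun p _ => ?_
    rw [linProd, Real.log_prod fun K _ => (hpos K).ne', Complex.ofReal_sum, ← sum_neg_distrib]
    congr 1
    refine sum_congr rfl fun K _ => ?_
    have hc : (m : ℂ) + (b 0 : ℂ) + ∑ k ∈ K, (b k.succ : ℂ) =
        (((m : ℝ) + b 0 + ∑ j ∈ K, b j.succ : ℝ) : ℂ) := by push_cast; rfl
    rw [hc, logGamma_zero (by simpa using! hpos K), Complex.ofReal_log (hpos K).le]
  have hsum : ∑ p ∈ range (N + 1), (-1 : ℝ) ^ p * -Real.log (linProd b p m) =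
      Real.log (altProd b m) := by
    rw [altProd, Real.log_div (prod_pos fun p _ => hlin p).ne' (prod_pos fun p _ => hlin p).ne',
      Real.log_prod fun p _ => (hlin p).ne', Real.log_prod fun p _ => (hlin p).ne',
      ← sum_filter_add_sum_filter_not (range (N + 1)) Odd, sub_eq_add_neg, ← sum_neg_distrib]
    simp_rw [Nat.not_odd_iff_even]
    congr 1
    · exact sum_congr rfl fun p hp => by rw [(mem_filter.mp hp).2.neg_one_pow]; ring
    · exact sum_congr rfl fun p hp => by rw [(mem_filter.mp hp).2.neg_one_pow]; ring
  have halt : 0 < altProd b m := div_pos (prod_pos fun p _ => hlin p) (prod_pos fun p _ => hlin p)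
  rw [hL, hsum]
  have hc : ((-1 : ℂ) ^ M * (Real.log (altProd b m) : ℂ)) =
      (((-1 : ℝ) ^ M * Real.log (altProd b m) : ℝ) : ℂ) := by push_cast; rfl
  rw [hc, ← Complex.ofReal_exp]
  congr 1
  rcases Nat.even_or_odd M with h | h
  · rw [h.neg_one_pow, h.neg_one_pow, one_mul, zpow_one, Real.exp_log halt]
  · rw [h.neg_one_pow, h.neg_one_pow, neg_one_mul, zpow_neg_one, Real.exp_neg, Real.exp_log halt]

end BarnesBeta
end

theorem mainTheorem12 (M N : ℕ) (hM : 1 ≤ M) (hMN : M ≤ N)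
    (b : Fin (N + 1) → ℝ) (hb : ∀ k, 0 < b k) :
    (∃! μ : Measure ℝ, BarnesBeta.IsBarnesBeta (fun _ : Fin M => (1 : ℝ)) b μ) ∧
    ∀ μ : Measure ℝ, BarnesBeta.IsBarnesBeta (fun _ : Fin M => (1 : ℝ)) b μ →
      ∀ n : ℕ,
        Integrable (fun x : ℝ => x ^ n) μ ∧
        ((∫ x : ℝ, x ^ n ∂μ : ℝ) : ℂ) =
          (∏ i ∈ Finset.Icc 1 (M - 1), Complex.exp ((-1 : ℂ) ^ i * (n.choose i : ℂ) *
            BarnesBeta.opS b (BarnesBeta.logGamma (fun _ : Fin (M - i) => (1 : ℝ))) 0)) *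
          BarnesBeta.nestedProd (fun m : ℕ => Complex.exp ((-1 : ℂ) ^ M *
            BarnesBeta.opS b (BarnesBeta.logGamma (fun _ : Fin 0 => (1 : ℝ))) (m : ℂ))) M n ∧
        ((∫ x : ℝ, x ^ n ∂μ : ℝ) : ℂ) =
          (∏ i ∈ Finset.Icc 1 (M - 1), Complex.exp ((-1 : ℂ) ^ i * (n.choose i : ℂ) *
            BarnesBeta.opS b (BarnesBeta.logGamma (fun _ : Fin (M - i) => (1 : ℝ))) 0)) *
          BarnesBeta.nestedProd (fun m : ℕ =>
            ((BarnesBeta.altProd b (m : ℝ) ^ ((-1 : ℤ) ^ M) : ℝ) : ℂ)) M n := by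
  obtain ⟨μ₀, hμ₀⟩ := BarnesBeta.exists_isBarnesBeta hMN b hb
  refine ⟨⟨μ₀, hμ₀, fun μ hμ => hμ.unique (hb 0) hμ₀⟩, fun μ hμ n => ?_⟩
  obtain ⟨h1, h2⟩ := hμ.moment (hb 0) n
  rw [BarnesBeta.eta_natCast hM b hb] at h2
  refine ⟨h1, h2, ?_⟩
  rw [h2]
  simp_rw [BarnesBeta.exp_neg_one_pow_mul_opS b hb]
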